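/- Candidates are named by natural numbers. An election $(C,V)$ consists of a finite candidate set $C$ and a finite list $V$ of voters, each with a strict linear preference order over $C$; if a subset $S$ of the candidates takes part, the preference orders are restricted to $S$. For $k\ge 1$, the $k$-Approval score of $c\in S$ in the election $(S,V)$ is the number of voters that rank $c$ among their top $k$ candidates of $S$; the candidates with the highest score win, and $p$ is the unique winner if it is the only candidate with the highest score. A preference order $>$ is single-peaked with respect to a linear order $L$ (the societal axis) if for all candidates $a,b,c$ with $a\,L\,b\,L\,c$ or $c\,L\,b\,L\,a$, $a>b$ implies $b>c$. Consider the following counting problems for $k$-Approval, restricted to single-peaked profiles; the societal axis is part of the input. (i) Adding candidates. Given disjoint finite sets $C$ (registered candidates) and $A$ (unregistered candidates), a linear order $L$ over $C\cup A$, a finite list $V$ of voters whose preference orders over $C\cup A$ are single-peaked with respect to $L$, a designated candidate $p\in C$, and an integer $\ell\ge 0$: $k$-Approval-\#CCAC asks for the number of sets $A'\subseteq A$ with $|A'|\le \ell$ such that $p$ is the unique winner of the $k$-Approval election $(C\cup A',V)$; $k$-Approval-\#DCAC asks for the number of such sets $A'$ for which $p$ is not the unique winner. (ii) Deleting candidates.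 Given a finite set $C$, a linear order $L$ over $C$, a finite list $V$ of voters whose preference orders over $C$ are single-peaked with respect to $L$, a designated candidate $p\in C$, and an integer $\ell\ge 0$: $k$-Approval-\#CCDC asks for the number of sets $C'\subseteq C$ with $|C'|\le\ell$ and $p\notin C'$ such that $p$ is the unique winner of the $k$-Approval election $(C\setminus C',V)$; $k$-Approval-\#DCDC asks for the number of such sets $C'$ for which $p$ is not the unique winner. Theorem. For every fixed integer $k\ge 1$, each of the four problems $k$-Approval-\#CCAC, $k$-Approval-\#CCDC, $k$-Approval-\#DCAC and $k$-Approval-\#DCDC, restricted to single-peaked profiles as above, is in FP: there is a deterministic Turing machine that, given an instance of the problem (sets and orders written as lists of candidates, all numbers and candidate names in binary), outputs the number asked for in binary, within a number of steps bounded by a polynomial in the length of the input. -/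

import Mathlib

open Computability

/-! ### Preference orders, single-peakedness -/

/-- The list `v` (a preference order, most preferred first, or a linear order given as the list of
its elements in increasing order) places `a` strictly before `b`. -/
def Precedes {α : Type} [DecidableEq α] (v : List α) (a b : α) : Prop :=
  v.idxOf a < v.idxOf b

/-- The preference order `v` is single-peaked with respect to the societal axis `L`. -/
def SinglePeaked {α : Type} [DecidableEq α] (L v : List α) : Prop :=
  ∀ a ∈ L, ∀ b ∈ L, ∀ c ∈ L,
    ((Precedes L a b ∧ Precedes L b c) ∨ (Precedes L c b ∧ Precedes L b a)) →
      (Precedes v a b → Precedes v b c)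

/-! ### Elections and voting rules -/

/-- A voting rule maps an election, i.e. a candidate set `S` together with a list of preference
orders over `S`, to the set of its winners. -/
abbrev VotingRule (α : Type) : Type := Finset α → List (List α) → Finset α

/-- The votes `V` restricted to the candidates in `S`. -/
def restrictVotes {α : Type} [DecidableEq α] (S : Finset α) (V : List (List α)) : List (List α) :=
  V.map fun v => v.filter fun c => c ∈ S

/-- The `k`-Approval score of `c`: the number of voters that rank `c` among their top `k`
candidates. -/
def kApprovalScore {α : Type} [DecidableEq α] (k : ℕ) (V : List (List α)) (c : α) : ℕ :=
  V.countP fun v => c ∈ v.take k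

/-- The `k`-Approval rule: the candidates with highest score win. -/
def kApproval {α : Type} [DecidableEq α] (k : ℕ) : VotingRule α := fun S V =>
  S.filter fun c => ∀ d ∈ S, kApprovalScore k V d ≤ kApprovalScore k V c

/-- `p` is the unique winner of the `R`-election with candidate set `S` and the voters `V`, whose
preference orders (over a possibly larger set of candidates) are restricted to `S`. -/
def IsUniqueWinner {α : Type} [DecidableEq α] (R : VotingRule α) (S : Finset α)
    (V : List (List α)) (p : α) : Prop :=
  R S (restrictVotes S V) = {p}

/-! ### Instances of control problems, single-peaked case -/

/-- A single-peaked instance of control by adding candidates: registered candidates `C`,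
unregistered candidates `A` (disjoint from `C`), a societal axis listing `C ∪ A` without
repetitions, voters with single-peaked preference orders over `C ∪ A`, the designated candidate
`p ∈ C`, and the bound on the number of candidates that may be added. -/
structure ACInstance (α : Type) [DecidableEq α] where
  C : List α
  A : List α
  axis : List α
  V : List (List α)
  p : α
  bound : ℕ
  axis_nodup : axis.Nodup
  axis_perm : axis.Perm (C ++ A)
  votes_perm : ∀ v ∈ V, v.Perm axis
  votes_singlePeaked : ∀ v ∈ V, SinglePeaked axis v
  p_mem : p ∈ C

/-- A single-peaked instance of control by deleting candidates: candidates `C`, a societal axis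
listing `C` without repetitions, voters with single-peaked preference orders over `C`, the
designated candidate `p ∈ C`, and the bound on the number of candidates that may be deleted. -/
structure DCInstance (α : Type) [DecidableEq α] where
  C : List α
  axis : List α
  V : List (List α)
  p : α
  bound : ℕ
  axis_nodup : axis.Nodup
  axis_perm : axis.Perm C
  votes_perm : ∀ v ∈ V, v.Perm axis
  votes_singlePeaked : ∀ v ∈ V, SinglePeaked axis v
  p_mem : p ∈ C

/-! ### The counting problems -/

section Counting

open Classical in
/-- `R`-#CCAC: the number of sets `A' ⊆ A` with `‖A'‖ ≤ bound` such that `p` is the unique winner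
of `(C ∪ A', V)`. -/
noncomputable def countCCAC {α : Type} [DecidableEq α] (R : VotingRule α) (I : ACInstance α) : ℕ :=
  (I.A.toFinset.powerset.filter fun A' =>
    A'.card ≤ I.bound ∧ IsUniqueWinner R (I.C.toFinset ∪ A') I.V I.p).card

open Classical in
/-- `R`-#DCAC: the number of sets `A' ⊆ A` with `‖A'‖ ≤ bound` such that `p` is not the unique
winner of `(C ∪ A', V)`. -/
noncomputable def countDCAC {α : Type} [DecidableEq α] (R : VotingRule α) (I : ACInstance α) : ℕ :=
  (I.A.toFinset.powerset.filter fun A' =>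
    A'.card ≤ I.bound ∧ ¬ IsUniqueWinner R (I.C.toFinset ∪ A') I.V I.p).card

open Classical in
/-- `R`-#CCDC: the number of sets `C' ⊆ C` with `‖C'‖ ≤ bound` and `p ∉ C'` such that `p` is the
unique winner of `(C - C', V)`. -/
noncomputable def countCCDC {α : Type} [DecidableEq α] (R : VotingRule α) (I : DCInstance α) : ℕ :=
  (I.C.toFinset.powerset.filter fun C' =>
    C'.card ≤ I.bound ∧ I.p ∉ C' ∧ IsUniqueWinner R (I.C.toFinset \ C') I.V I.p).card

open Classical in
/-- `R`-#DCDC: the number of sets `C' ⊆ C` with `‖C'‖ ≤ bound` and `p ∉ C'` such that `p` is not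
the unique winner of `(C - C', V)`. -/
noncomputable def countDCDC {α : Type} [DecidableEq α] (R : VotingRule α) (I : DCInstance α) : ℕ :=
  (I.C.toFinset.powerset.filter fun C' =>
    C'.card ≤ I.bound ∧ I.p ∉ C' ∧ ¬ IsUniqueWinner R (I.C.toFinset \ C') I.V I.p).card

end Counting

/-! ### Encodings of instances as words; the class FP

Words are over the alphabet `Γ'` (two bits, a comma, two brackets, a blank). Numbers, among them the
names of candidates, are written in binary. -/

/-- A natural number in binary, closed by a comma. -/
def natWord (n : ℕ) : List Γ' :=
  (encodeNat n).map Γ'.bit ++ [Γ'.comma]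

/-- A list, as the concatenation of the words of its entries between brackets. -/
def listWord {β : Type} (enc : β → List Γ') (l : List β) : List Γ' :=
  Γ'.bra :: (l.flatMap enc ++ [Γ'.ket])

def ACInstance.word (I : ACInstance ℕ) : List Γ' :=
  listWord natWord I.C ++ listWord natWord I.A ++ listWord natWord I.axis ++
    listWord (listWord natWord) I.V ++ natWord I.p ++ natWord I.bound

def DCInstance.word (I : DCInstance ℕ) : List Γ' :=
  listWord natWord I.C ++ listWord natWord I.axis ++
    listWord (listWord natWord) I.V ++ natWord I.p ++ natWord I.bound

/-- A counting problem `f`, whose instances are written as words by `enc`, is in FP: some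
deterministic Turing machine, given the word of an instance `I`, writes `f I` in binary within a
number of steps that is bounded by a polynomial in the length of that word. -/
def InFP {ι : Type} (enc : ι → List Γ') (f : ι → ℕ) : Prop :=
  Nonempty (Turing.TM2ComputableInPolyTime enc encodeNat f)

/-! Scores. List the participants along the axis. A single-peaked voter's ranking improves up to a
peak and then worsens, so a voter approves of a participant `c` exactly when neither the participant
`k` places to the left of `c` nor the one `k` places to the right is preferred to `c` (a missing one
never is). Both cannot be preferred at once. Hence the score of `c` is the number of voters, minus
those preferring the left neighbour, minus those preferring the right one (`vote_approves_iff`,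
`score_add_losing`): it depends on three candidates only.

Counting. Guess the two `k`-th neighbours of `p`; the guess determines the score of `p`. An
automaton that reads the participants along the axis and remembers the last `2 * k` of them can then
check, for each participant in turn, that the guess is right and whether `p` is at least tied.
Together with a cost counter and two flags this gives polynomially many states, as `k` is fixed. A
set of added or deleted candidates corresponds to one path of the automaton (`countP_scanChoices`),
so dynamic programming counts the sets for which a guess is right and the desired outcome occurs.
Each set has exactly one right guess (`sum_card_guess`), so the sum over all guesses is the number
asked for (`solve_eq`). Two Boolean parameters, adding or deleting and beaten or not, cover the four
problems.

Complexity. Structured programs on finitely many stacks compile to `TM2` machines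
(`Cmd.Run.iterate_step`). Data are binary trees, kept in prefix code on one stack. A `PolyTime`
function is computed by a program that replaces the top tree and leaves all beneath it untouched,
with polynomial bounds on time and on the size of the result. This class is closed under
composition, pairing, case distinction, and iteration with polynomially many rounds and polynomially
bounded intermediate results, so that `fun_prop` can assemble the algorithm. The table entries need
an argument: a state has at most two moves, so after `n` items an entry is at most `2 ^ n` and has
linearly many bits (`scanTable_fold`). `PolyTime.inFP` adds the reading of the input word and the
writing of the binary output. -/

/-! ### A structured language of stack programs, and its compilation to `TM2` -/

section StackPrograms

open Turing Function

/-- Structured programs acting on a family of stacks and an internal state. -/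
inductive Cmd {K : Type} (Γ : K → Type) (σ : Type) : Type
  | push (k : K) (f : σ → Γ k) : Cmd Γ σ
  | pop (k : K) (f : σ → Option (Γ k) → σ) : Cmd Γ σ
  | load (f : σ → σ) : Cmd Γ σ
  | seq (c d : Cmd Γ σ) : Cmd Γ σ
  | ite (b : σ → Bool) (c d : Cmd Γ σ) : Cmd Γ σ
  | loop (b : σ → Bool) (c : Cmd Γ σ) : Cmd Γ σ

namespace Cmd

variable {K : Type} {Γ : K → Type} {σ : Type}

/-- `Run c v S t v' S'`: the program `c`, started in state `v` with stacks `S`, terminates after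
exactly `t` steps in state `v'` with stacks `S'`. -/
inductive Run [DecidableEq K] :
    Cmd Γ σ → σ → (∀ k, List (Γ k)) → ℕ → σ → (∀ k, List (Γ k)) → Prop
  | push {k f v S} : Run (.push k f) v S 1 v (update S k (f v :: S k))
  | pop {k f v S} : Run (.pop k f) v S 1 (f v (S k).head?) (update S k (S k).tail)
  | load {f v S} : Run (.load f) v S 1 (f v) S
  | seq {c d v S t v₁ S₁ t' v₂ S₂} : Run c v S t v₁ S₁ → Run d v₁ S₁ t' v₂ S₂ →
      Run (.seq c d) v S (t + t') v₂ S₂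
  | ite_true {b c d v S t v₁ S₁} : b v = true → Run c v S t v₁ S₁ →
      Run (.ite b c d) v S (t + 1) v₁ S₁
  | ite_false {b c d v S t v₁ S₁} : b v = false → Run d v S t v₁ S₁ →
      Run (.ite b c d) v S (t + 1) v₁ S₁
  | loop_done {b c v S} : b v = false → Run (.loop b c) v S 1 v S
  | loop_step {b c v S t v₁ S₁ t' v₂ S₂} : b v = true → Run c v S t v₁ S₁ →
      Run (.loop b c) v₁ S₁ t' v₂ S₂ → Run (.loop b c) v S (t + t' + 1) v₂ S₂

/-- The labels of the machine that a program is compiled to. -/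
def Lab : Cmd Γ σ → Type
  | push _ _ => Unit
  | pop _ _ => Unit
  | load _ => Unit
  | seq c d => c.Lab ⊕ d.Lab
  | ite _ c d => Option (c.Lab ⊕ d.Lab)
  | loop _ c => Option c.Lab

/-- The label at which a compiled program is entered. -/
def entry : (c : Cmd Γ σ) → c.Lab
  | push _ _ => ()
  | pop _ _ => ()
  | load _ => ()
  | seq c _ => Sum.inl c.entry
  | ite _ _ _ => none
  | loop _ _ => none

theorem lab_finite : ∀ c : Cmd Γ σ, Finite c.Lab
  | push _ _ => inferInstanceAs (Finite Unit)
  | pop _ _ => inferInstanceAs (Finite Unit)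
  | load _ => inferInstanceAs (Finite Unit)
  | seq c d => by
      have := lab_finite c; have := lab_finite d
      exact inferInstanceAs (Finite (c.Lab ⊕ d.Lab))
  | ite _ c d => by
      have := lab_finite c; have := lab_finite d
      exact inferInstanceAs (Finite (Option (c.Lab ⊕ d.Lab)))
  | loop _ c => by
      have := lab_finite c
      exact inferInstanceAs (Finite (Option c.Lab))

/-- The statements of a compiled program, whose labels are embedded by `e` into those of a machine
and which jumps to `exit` when it terminates. -/
def stmt {Λ : Type} : (c : Cmd Γ σ) → (c.Lab → Λ) → Λ → c.Lab → TM2.Stmt Γ Λ σ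
  | push k f, _, exit, _ => .push k f (.goto fun _ => exit)
  | pop k f, _, exit, _ => .pop k f (.goto fun _ => exit)
  | load f, _, exit, _ => .load f (.goto fun _ => exit)
  | seq c d, e, _, Sum.inl l => c.stmt (fun l => e (Sum.inl l)) (e (Sum.inr d.entry)) l
  | seq _ d, e, exit, Sum.inr l => d.stmt (fun l => e (Sum.inr l)) exit l
  | ite b c d, e, _, none =>
      .branch b (.goto fun _ => e (some (Sum.inl c.entry)))
        (.goto fun _ => e (some (Sum.inr d.entry)))
  | ite _ c _, e, exit, some (Sum.inl l) => c.stmt (fun l => e (some (Sum.inl l))) exit l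
  | ite _ _ d, e, exit, some (Sum.inr l) => d.stmt (fun l => e (some (Sum.inr l))) exit l
  | loop b c, e, exit, none => .branch b (.goto fun _ => e (some c.entry)) (.goto fun _ => exit)
  | loop _ c, e, _, some l => c.stmt (fun l => e (some l)) (e none) l

variable [DecidableEq K]

/-- Induction on the run. The embedding of the labels and the exit label vary, because a subprogram
occupies part of the labels of the larger machine: the first half of a sequence exits to the entry
of the second, and the body of a loop exits to the test of the loop. -/
theorem Run.iterate_step {c : Cmd Γ σ} {v S t v' S'} (h : Run c v S t v' S') {Λ : Type}
    (M : Λ → TM2.Stmt Γ Λ σ) (e : c.Lab → Λ) (exit : Λ) (hM : ∀ l, M (e l) = c.stmt e exit l) :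
    (flip bind (TM2.step M))^[t] (some ⟨some (e c.entry), v, S⟩) = some ⟨some exit, v', S'⟩ := by
  have step_eq : ∀ (c : Cmd Γ σ) (e : c.Lab → Λ) (exit : Λ)
      (_ : ∀ l, M (e l) = c.stmt e exit l) (v : σ) (S : ∀ k, List (Γ k)),
      flip bind (TM2.step M) (some ⟨some (e c.entry), v, S⟩) =
        some (TM2.stepAux (c.stmt e exit c.entry) v S) := by
    intro c e exit hM v S
    simp [flip, hM]
  induction h generalizing exit with
  | push => exact step_eq _ e exit hM _ _
  | pop => exact step_eq _ e exit hM _ _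
  | load => exact step_eq _ e exit hM _ _
  | @seq c d _ _ _ _ _ _ _ _ _ _ ihc ihd =>
    rw [Nat.add_comm, iterate_add_apply]
    erw [ihc (fun l => e (Sum.inl l)) (e (Sum.inr d.entry)) (fun l => hM (Sum.inl l))]
    exact ihd (fun l => e (Sum.inr l)) exit (fun l => hM (Sum.inr l))
  | @ite_true b c d v S t v₁ S₁ hb _ ih =>
    rw [iterate_succ_apply, step_eq _ e exit hM,
      ← ih (fun l => e (some (Sum.inl l))) exit (fun l => hM (some (Sum.inl l)))]
    simp [stmt, entry, hb]
  | @ite_false b c d v S t v₁ S₁ hb _ ih =>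
    rw [iterate_succ_apply, step_eq _ e exit hM,
      ← ih (fun l => e (some (Sum.inr l))) exit (fun l => hM (some (Sum.inr l)))]
    simp [stmt, entry, hb]
  | loop_done hb =>
    refine (step_eq _ e exit hM _ _).trans ?_
    simp [stmt, entry, hb]
  | @loop_step b c v S t v₁ S₁ t' v₂ S₂ hb _ _ ihc ihl =>
    rw [iterate_succ_apply, step_eq _ e exit hM, Nat.add_comm, iterate_add_apply,
      ← ihl e exit hM]
    change _ = (flip bind (TM2.step M))^[t'] (some ⟨some (e none), v₁, S₁⟩)
    rw [← ihc (fun l => e (some l)) (e none) (fun l => hM (some l))]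
    simp [stmt, entry, hb]

/-- The machine running a program from input stack `k₀` to output stack `k₁`. -/
noncomputable def toFinTM2 [Fintype K] [Fintype σ] (c : Cmd Γ σ) (k₀ k₁ : K) [Fintype (Γ k₀)]
    (v₀ : σ) : FinTM2 where
  K := K
  k₀ := k₀
  k₁ := k₁
  Γ := Γ
  Λ := Option c.Lab
  main := some c.entry
  ΛFin := by
    have := c.lab_finite
    exact Fintype.ofFinite _
  σ := σ
  initialState := v₀
  m := fun l => match l with
    | none => .halt
    | some l => c.stmt some none l

/-- The additional step executes `halt`. The run must end in the initial state `v₀`, because the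
halting configurations of a `FinTM2` require it. -/
theorem Run.toFinTM2 [Fintype K] [Fintype σ] {c : Cmd Γ σ} {k₀ k₁ : K} [Fintype (Γ k₀)] {v₀ : σ}
    {S t S'} (h : Run c v₀ S t v₀ S') :
    (flip bind (c.toFinTM2 k₀ k₁ v₀).step)^[t + 1] (some ⟨some (some c.entry), v₀, S⟩) =
      some ⟨none, v₀, S'⟩ := by
  have h1 := h.iterate_step (c.toFinTM2 k₀ k₁ v₀).m some none (fun _ => rfl)
  rw [iterate_succ_apply']
  erw [h1]
  rfl

/-- `c` takes `(v, S)` to `(v', S')` in at most `T` steps. -/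
def Runs (c : Cmd Γ σ) (v : σ) (S : ∀ k, List (Γ k)) (T : ℕ) (v' : σ) (S' : ∀ k, List (Γ k)) :
    Prop :=
  ∃ t ≤ T, Run c v S t v' S'

theorem Runs.mono {c : Cmd Γ σ} {v S T T' v' S'} (h : Runs c v S T v' S') (hT : T ≤ T') :
    Runs c v S T' v' S' :=
  let ⟨t, ht, hr⟩ := h; ⟨t, ht.trans hT, hr⟩

theorem Runs.push {k : K} {f : σ → Γ k} {v S S'} (h : update S k (f v :: S k) = S') :
    Runs (.push k f) v S 1 v S' := h ▸ ⟨1, le_rfl, .push⟩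

theorem Runs.pop {k : K} {f : σ → Option (Γ k) → σ} {v v' S S'} (hv : f v (S k).head? = v')
    (h : update S k (S k).tail = S') : Runs (.pop k f) v S 1 v' S' :=
  h ▸ hv ▸ ⟨1, le_rfl, .pop⟩

theorem Runs.load {f : σ → σ} {v v'} {S : ∀ k, List (Γ k)} (hv : f v = v') :
    Runs (.load f) v S 1 v' S :=
  hv ▸ ⟨1, le_rfl, .load⟩

theorem Runs.seq {c d : Cmd Γ σ} {v S T v₁ S₁ T' v₂ S₂} (h : Runs c v S T v₁ S₁)
    (h' : Runs d v₁ S₁ T' v₂ S₂) : Runs (.seq c d) v S (T + T') v₂ S₂ :=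
  let ⟨t, ht, hr⟩ := h; let ⟨t', ht', hr'⟩ := h'; ⟨t + t', add_le_add ht ht', hr.seq hr'⟩

theorem Runs.ite_true {b : σ → Bool} {c d : Cmd Γ σ} {v S T v₁ S₁} (hb : b v = true)
    (h : Runs c v S T v₁ S₁) : Runs (.ite b c d) v S (T + 1) v₁ S₁ :=
  let ⟨t, ht, hr⟩ := h; ⟨t + 1, by omega, hr.ite_true hb⟩

theorem Runs.ite_false {b : σ → Bool} {c d : Cmd Γ σ} {v S T v₁ S₁} (hb : b v = false)
    (h : Runs d v S T v₁ S₁) : Runs (.ite b c d) v S (T + 1) v₁ S₁ :=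
  let ⟨t, ht, hr⟩ := h; ⟨t + 1, by omega, hr.ite_false hb⟩

theorem Runs.loop_done {b : σ → Bool} {c : Cmd Γ σ} {v S} (hb : b v = false) :
    Runs (.loop b c) v S 1 v S := ⟨1, le_rfl, .loop_done hb⟩

theorem Runs.loop_step {b : σ → Bool} {c : Cmd Γ σ} {v S T v₁ S₁ T' v₂ S₂} (hb : b v = true)
    (h : Runs c v S T v₁ S₁) (h' : Runs (.loop b c) v₁ S₁ T' v₂ S₂) :
    Runs (.loop b c) v S (T + T' + 1) v₂ S₂ :=
  let ⟨t, ht, hr⟩ := h; let ⟨t', ht', hr'⟩ := h'; ⟨t + t' + 1, by omega, .loop_step hb hr hr'⟩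

end Cmd

end StackPrograms

/-! ### S-expressions on a stack -/

section Sexps

open Turing Function

/-- Binary trees, as built by `cons` from `nil`. -/
inductive Sexp : Type
  | nil
  | cons (x y : Sexp)

namespace Sexp

/-- The prefix-free code of a tree as a word of bits. -/
def code : Sexp → List Bool
  | nil => [false]
  | cons x y => true :: (x.code ++ y.code)

def size (x : Sexp) : ℕ := x.code.length

@[simp] theorem size_nil : nil.size = 1 := rfl

@[simp] theorem size_cons (x y : Sexp) : (cons x y).size = x.size + y.size + 1 := by
  simp [size, code]

theorem size_pos (x : Sexp) : 0 < x.size := by cases x <;> simp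

def car : Sexp → Sexp
  | nil => nil
  | cons x _ => x

def cdr : Sexp → Sexp
  | nil => nil
  | cons _ y => y

end Sexp

/-- The stacks, besides the input stack, of the machines used below. -/
inductive Reg : Type
  | main
  | aux (d : Bool)
  | cnt
  deriving DecidableEq, Fintype

@[reducible] def RegAlphabet : Option Reg → Type
  | none => Γ'
  | some _ => Bool

instance : Fintype (RegAlphabet none) := inferInstanceAs (Fintype Γ')

abbrev RegCmd : Type := Cmd RegAlphabet (Option Γ')

/-- The family of stacks with the given contents. -/
def regs (i : List Γ') (m : List Bool) (x : Bool → List Bool) (n : List Bool) :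
    ∀ k, List (RegAlphabet k)
  | none => i
  | some .main => m
  | some (.aux d) => x d
  | some .cnt => n

section regs

variable (i : List Γ') (m : List Bool) (x : Bool → List Bool) (n : List Bool)

@[simp] theorem regs_inp : regs i m x n none = i := rfl
@[simp] theorem regs_main : regs i m x n (some .main) = m := rfl
@[simp] theorem regs_aux (d : Bool) : regs i m x n (some (.aux d)) = x d := rfl
@[simp] theorem regs_cnt : regs i m x n (some .cnt) = n := rfl

@[simp] theorem update_regs_inp (l : List Γ') :
    update (regs i m x n) none l = regs l m x n := by
  funext k; rcases k with _ | _ | _ | _ <;> rfl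

@[simp] theorem update_regs_main (l : List Bool) :
    update (regs i m x n) (some .main) l = regs i l x n := by
  funext k; rcases k with _ | _ | _ | _ <;> rfl

@[simp] theorem update_regs_aux (d : Bool) (l : List Bool) :
    update (regs i m x n) (some (.aux d)) l = regs i m (update x d l) n := by
  funext k; rcases k with _ | _ | d' | _
  · rfl
  · rfl
  · by_cases h : d' = d
    · subst h; simp
    · simp [h]
  · rfl

@[simp] theorem update_regs_cnt (l : List Bool) :
    update (regs i m x n) (some .cnt) l = regs i m x l := by
  funext k; rcases k with _ | _ | _ | _ <;> rfl

end regs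

/-! ### Subroutines that move, copy, swap and discard trees in linear time -/

namespace RegCmd

def pushBit (r : Reg) (b : Bool) : RegCmd := .push (some r) fun _ => b

/-- Push the bit held by the internal state. -/
def pushState (r : Reg) : RegCmd := .push (some r) fun v => decide (v = some (.bit true))

def popBit (r : Reg) : RegCmd := .pop (some r) fun _ o => o.map Γ'.bit

def isTrue (v : Option Γ') : Bool := decide (v = some (.bit true))

/-- Move the tree on top of the main stack to an auxiliary stack, reversing its code. -/
def moveLoop (d : Bool) : RegCmd :=
  .loop Option.isSome <| .seq (popBit .main) <| .seq
    (.ite isTrue (.seq (pushBit (.aux d) true) (.seq (pushBit .cnt true) (pushBit .cnt true)))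
      (pushBit (.aux d) false))
    (popBit .cnt)

/-- The end of a tree is found by counting the subtrees still to be read: one is announced by a
state different from `none`, the others are tokens on `cnt`. A bit `true` uses up one token and adds
two, a bit `false` uses up one. The continuation form, with the remaining run as hypothesis, lets
the induction chain the two subtrees of a `cons`. -/
theorem moveLoop_runs (d : Bool) (i : List Γ') (x : Bool → List Bool) (t : Sexp) :
    ∀ (rest acc n : List Bool) (s : Γ') {T v' S'},
      Cmd.Runs (moveLoop d) (n.head?.map Γ'.bit)
        (regs i rest (update x d (t.code.reverse ++ acc)) n.tail) T v' S' →
      Cmd.Runs (moveLoop d) (some s) (regs i (t.code ++ rest) (update x d acc) n)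
        (T + 8 * t.size) v' S' := by
  induction t with
  | nil =>
    intro rest acc n s T v' S' h
    refine (Cmd.Runs.loop_step rfl ((Cmd.Runs.pop (v' := some (.bit false)) rfl rfl).seq
      ((Cmd.Runs.ite_false rfl (.push rfl)).seq (.pop rfl rfl))) ?_).mono
        (show 1 + (1 + 1 + 1) + T + 1 ≤ _ by simp; omega)
    simpa [Sexp.code, moveLoop, popBit, pushBit] using h
  | cons t u iht ihu =>
    intro rest acc n s T v' S' h
    have h1 := ihu rest (t.code.reverse ++ true :: acc) n (.bit true) (T := T) (v' := v') (S' := S')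
      (by simpa [Sexp.code] using h)
    have h2 := iht (u.code ++ rest) (true :: acc) (true :: n) (.bit true) h1
    refine (Cmd.Runs.loop_step rfl ((Cmd.Runs.pop (v' := some (.bit true)) rfl rfl).seq
      ((Cmd.Runs.ite_true rfl ((Cmd.Runs.push rfl).seq ((Cmd.Runs.push rfl).seq
        (.push rfl)))).seq (.pop rfl rfl))) ?_).mono
        (show 1 + (1 + (1 + 1) + 1 + 1) + (T + 8 * u.size + 8 * t.size) + 1 ≤ _ by simp; omega)
    simpa [Sexp.code, moveLoop, popBit, pushBit] using h2

/-- Pushing and popping a token brings the state, whatever it was, to announce exactly one tree to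
be read. -/
def moveTree (d : Bool) : RegCmd :=
  .seq (pushBit .cnt true) (.seq (popBit .cnt) (moveLoop d))

theorem moveTree_runs (d : Bool) (i : List Γ') (x : Bool → List Bool) (t : Sexp)
    (rest : List Bool) (v : Option Γ') :
    Cmd.Runs (moveTree d) v (regs i (t.code ++ rest) x [])
      (8 * t.size + 3) none (regs i rest (update x d (t.code.reverse ++ x d)) []) := by
  have h1 := moveLoop_runs d i x t rest (x d) [] (.bit true)
    (Cmd.Runs.loop_done (b := Option.isSome) rfl)
  refine ((Cmd.Runs.push rfl).seq ((Cmd.Runs.pop (v' := some (.bit true)) rfl rfl).seq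
    (T' := 1 + 8 * t.size) ?_)).mono (show 1 + (1 + (1 + 8 * t.size)) ≤ _ by omega)
  simpa using h1

/-- Pop the symbols of a stack one after the other, and run `c` after each of them. -/
def drain (k : Option Reg) (g : RegAlphabet k → Γ') (c : RegCmd) : RegCmd :=
  .seq (.pop k fun _ o => o.map g) (.loop Option.isSome (.seq c (.pop k fun _ o => o.map g)))

/-- The accumulator `a` describes all stacks other than the drained one, and `F l a` is the whole
configuration; draining thus amounts to a left fold of `s`. -/
theorem drain_runs {k : Option Reg} {g : RegAlphabet k → Γ'} {c : RegCmd} {A : Type}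
    (F : List (RegAlphabet k) → A → ∀ k, List (RegAlphabet k)) (s : A → RegAlphabet k → A) {T : ℕ}
    (hF : ∀ l a, F l a k = l) (hF' : ∀ l l' a, update (F l a) k l' = F l' a)
    (hc : ∀ b l a, ∃ v', Cmd.Runs c (some (g b)) (F l a) T v' (F l (s a b)))
    (l : List (RegAlphabet k)) (a : A) (v : Option Γ') :
    Cmd.Runs (drain k g c) v (F l a) ((T + 2) * l.length + 2) none (F [] (l.foldl s a)) := by
  have key : ∀ (l : List (RegAlphabet k)) (a : A),
      Cmd.Runs (.loop Option.isSome (.seq c (.pop k fun _ o => o.map g))) (l.head?.map g)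
        (F l.tail a) ((T + 2) * l.length + 1) none (F [] (l.foldl s a)) := by
    intro l
    induction l with
    | nil => intro a; exact Cmd.Runs.loop_done rfl
    | cons b l ih =>
      intro a
      obtain ⟨v', h⟩ := hc b l a
      refine (Cmd.Runs.loop_step rfl (h.seq (.pop rfl rfl)) ?_).mono
        (show T + 1 + ((T + 2) * l.length + 1) + 1 ≤ _ by simp; ring_nf; omega)
      simpa [hF, hF'] using ih (s a b)
  refine ((Cmd.Runs.pop rfl rfl).seq ?_).mono (show 1 + ((T + 2) * l.length + 1) ≤ _ by omega)
  simpa [hF, hF'] using key l a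

/-- Empty an auxiliary stack onto the main stack. -/
def pourMain (d : Bool) : RegCmd := drain (some (.aux d)) Γ'.bit (pushState .main)

theorem pourMain_runs (d : Bool) (i : List Γ') (m : List Bool) (x : Bool → List Bool)
    (n : List Bool) (v : Option Γ') :
    Cmd.Runs (pourMain d) v (regs i m x n) (3 * (x d).length + 2) none
      (regs i ((x d).reverse ++ m) (update x d []) n) := by
  have := drain_runs (k := some (.aux d)) (g := Γ'.bit) (c := pushState .main) (T := 1)
    (fun l m => regs i m (update x d l) n) (fun m b => b :: m) (by simp) (by simp)
    (fun b l a => ⟨_, .push (by simp)⟩) (x d) m v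
  simpa [pourMain] using this

/-- Empty one auxiliary stack onto the other one. -/
def pourAux (d : Bool) : RegCmd := drain (some (.aux d)) Γ'.bit (pushState (.aux !d))

theorem pourAux_runs (d : Bool) (i : List Γ') (m : List Bool) (x : Bool → List Bool)
    (n : List Bool) (v : Option Γ') :
    Cmd.Runs (pourAux d) v (regs i m x n) (3 * (x d).length + 2) none
      (regs i m (update (update x (!d) ((x d).reverse ++ x (!d))) d []) n) := by
  have := drain_runs (k := some (.aux d)) (g := Γ'.bit) (c := pushState (.aux !d)) (T := 1)
    (fun l a => regs i m (update (update x (!d) a) d l) n) (fun m b => b :: m) (by simp) (by simp)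
    (fun b l a => ⟨_, .push (by cases d <;> simp [update_comm (show true ≠ false by simp)])⟩) (x d) (x (!d)) v
  simpa [pourAux] using this

/-- Empty the first auxiliary stack onto both the main stack and the other auxiliary stack. -/
def pourBoth : RegCmd :=
  drain (some (.aux true)) Γ'.bit (.seq (pushState .main) (pushState (.aux false)))

theorem pourBoth_runs (i : List Γ') (m l : List Bool) (n : List Bool) (v : Option Γ') :
    Cmd.Runs pourBoth v (regs i m (update (fun _ => []) true l) n) (4 * l.length + 2) none
      (regs i (l.reverse ++ m) (update (fun _ => []) false l.reverse) n) := by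
  have := drain_runs (k := some (.aux true)) (g := Γ'.bit)
    (c := .seq (pushState .main) (pushState (.aux false))) (T := 2)
    (fun l a => regs i (a ++ m) (update (update (fun _ => []) false a) true l) n)
    (fun m b => b :: m) (by simp) (by simp)
    (fun b l a => ⟨_, (Cmd.Runs.push rfl).seq (.push
      (by simp [update_comm (show true ≠ false by simp)]))⟩) l [] v
  have h0 : update (update (fun _ => []) false []) true l
    = update (fun _ => ([] : List Bool)) true l := by
    funext d; cases d <;> simp
  have h1 : update (update (fun _ => []) false l.reverse) true []
    = update (fun _ => ([] : List Bool)) false l.reverse := by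
    funext d; cases d <;> simp
  simpa [pourBoth, h0, h1] using this

/-- All stacks except the main one are empty. -/
def stks (w : List Bool) : ∀ k, List (RegAlphabet k) := regs [] w (fun _ => []) []

/-- Every transfer between stacks reverses a word. `pourBoth` undoes the reversal of the first move
and leaves a forward copy on the other auxiliary stack, which must be reversed once more before it
can be poured onto the main stack. -/
def dup : RegCmd := .seq (moveTree true) (.seq pourBoth (.seq (pourAux false) (pourMain true)))

theorem dup_runs (t : Sexp) (rest : List Bool) (v : Option Γ') :
    Cmd.Runs dup v (stks (t.code ++ rest)) (30 * t.size + 30) none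
      (stks (t.code ++ (t.code ++ rest))) := by
  have h1 := moveTree_runs true [] (fun _ => []) t rest v
  have h2 := pourBoth_runs [] rest t.code.reverse [] none
  have h3 := pourAux_runs false [] (t.code ++ rest) (update (fun _ => []) false t.code) [] none
  have h4 := pourMain_runs true [] (t.code ++ rest) (update (fun _ => []) true t.code.reverse)
    [] none
  have e1 : update (update (update (fun _ => []) false t.code) true t.code.reverse) false []
      = update (fun _ => ([] : List Bool)) true t.code.reverse := by
    funext d; cases d <;> simp
  have e2 : update (update (fun _ => []) true t.code.reverse) true [] =
      (fun _ => ([] : List Bool)) := by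
    funext d; cases d <;> simp
  simp only [List.append_nil, List.reverse_reverse, update_self, Bool.not_false, ne_eq,
    Bool.true_eq_false, not_false_eq_true, update_of_ne, e1, e2, List.length_reverse] at h1 h2 h3 h4
  exact (h1.seq (h2.seq (h3.seq h4))).mono (by simp only [Sexp.size]; omega)

def swap : RegCmd :=
  .seq (moveTree true) (.seq (moveTree false) (.seq (pourMain true) (pourMain false)))

theorem swap_runs (t u : Sexp) (rest : List Bool) (v : Option Γ') :
    Cmd.Runs swap v (stks (t.code ++ (u.code ++ rest))) (30 * (t.size + u.size) + 30) none
      (stks (u.code ++ (t.code ++ rest))) := by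
  have h1 := moveTree_runs true [] (fun _ => []) t (u.code ++ rest) v
  have h2 := moveTree_runs false [] (update (fun _ => []) true t.code.reverse) u rest none
  have h3 := pourMain_runs true [] rest
    (update (update (fun _ => []) true t.code.reverse) false u.code.reverse) [] none
  have h4 := pourMain_runs false [] (t.code ++ rest) (update (fun _ => []) false u.code.reverse)
    [] none
  have e1 : update (update (update (fun _ => []) true t.code.reverse) false u.code.reverse) true []
      = update (fun _ => ([] : List Bool)) false u.code.reverse := by
    funext d; cases d <;> simp
  have e2 : update (update (fun _ => []) false u.code.reverse) false [] =
      (fun _ => ([] : List Bool)) := by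
    funext d; cases d <;> simp
  simp only [List.append_nil, List.reverse_reverse, update_self, ne_eq,
    Bool.true_eq_false, Bool.false_eq_true, not_false_eq_true, update_of_ne, e1, e2,
    List.length_reverse] at h1 h2 h3 h4
  exact (h1.seq (h2.seq (h3.seq h4))).mono (by simp only [Sexp.size]; omega)

/-- Empty an auxiliary stack. -/
def clear : RegCmd := drain (some (.aux true)) Γ'.bit (.load id)

def drop : RegCmd := .seq (moveTree true) clear

theorem drop_runs (t : Sexp) (rest : List Bool) (v : Option Γ') :
    Cmd.Runs drop v (stks (t.code ++ rest)) (30 * t.size + 30) none (stks rest) := by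
  have h1 := moveTree_runs true [] (fun _ => []) t rest v
  have h2 := drain_runs (k := some (.aux true)) (g := Γ'.bit) (c := .load id) (T := 1)
    (fun l (_ : Unit) => regs [] rest (update (fun _ => []) true l) []) (fun m b => m)
    (by simp) (by simp) (fun b l a => ⟨_, .load rfl⟩) t.code.reverse () none
  have e2 : update (fun _ => []) true [] = (fun _ => ([] : List Bool)) := by
    funext d; cases d <;> simp
  simp only [List.append_nil, e2, List.length_reverse] at h1 h2
  exact (h1.seq h2).mono (by simp only [Sexp.size]; omega)

/-- Push a fixed word. -/
def emit (r : Reg) : List Bool → RegCmd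
  | [] => .load id
  | b :: w => .seq (emit r w) (pushBit r b)

theorem emit_main_runs (i : List Γ') (m : List Bool) (x : Bool → List Bool) (n : List Bool)
    (v : Option Γ') (w : List Bool) :
    Cmd.Runs (emit .main w) v (regs i m x n) (w.length + 1) v (regs i (w ++ m) x n) := by
  induction w with
  | nil => exact .load rfl
  | cons b w ih => exact ih.seq (.push (update_regs_main _ _ _ _ _))

theorem emit_aux_runs (d : Bool) (i : List Γ') (m : List Bool) (x : Bool → List Bool)
    (n : List Bool) (v : Option Γ') (w : List Bool) :
    Cmd.Runs (emit (.aux d) w) v (regs i m x n) (w.length + 1) v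
      (regs i m (update x d (w ++ x d)) n) := by
  induction w with
  | nil => rw [List.nil_append, update_eq_self]; exact .load rfl
  | cons b w ih => exact ih.seq (.push (by simp))

end RegCmd

end Sexps

/-! ### Polynomial-time functions between types represented by trees -/

section PolyTime

open Turing Function

/-- A representation of the elements of a type by trees. -/
class SexpRep (α : Type) where
  sexp : α → Sexp

open SexpRep

instance : SexpRep Sexp := ⟨id⟩
instance : SexpRep Unit := ⟨fun _ => .nil⟩
instance : SexpRep Bool := ⟨fun b => bif b then .cons .nil .nil else .nil⟩
instance {α β : Type} [SexpRep α] [SexpRep β] : SexpRep (α × β) :=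
  ⟨fun a => .cons (sexp a.1) (sexp a.2)⟩
instance {α : Type} [SexpRep α] : SexpRep (Option α) :=
  ⟨fun o => o.elim .nil fun a => .cons (sexp a) .nil⟩
instance {α : Type} [SexpRep α] : SexpRep (List α) :=
  ⟨fun l => l.foldr (fun a x => .cons (sexp a) x) .nil⟩
instance {α : Type} [SexpRep α] (p : α → Prop) : SexpRep (Subtype p) := ⟨fun a => sexp a.1⟩
instance : SexpRep ℕ := ⟨fun n => sexp (encodeNat n)⟩

/-- The size of the tree that represents `a`. -/
def sz {α : Type} [SexpRep α] (a : α) : ℕ := (sexp a).size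

section
variable {α β : Type} [SexpRep α] [SexpRep β]

@[simp] theorem sexp_sexp (x : Sexp) : sexp x = x := rfl
@[simp] theorem sexp_false : sexp false = .nil := rfl
@[simp] theorem sexp_true : sexp true = .cons .nil .nil := rfl
@[simp] theorem sexp_mk (a : α) (b : β) : sexp (a, b) = .cons (sexp a) (sexp b) := rfl
@[simp] theorem sexp_none : sexp (none : Option α) = .nil := rfl
@[simp] theorem sexp_some (a : α) : sexp (some a) = .cons (sexp a) .nil := rfl
@[simp] theorem sexp_nil : sexp ([] : List α) = .nil := rfl
@[simp] theorem sexp_cons (a : α) (l : List α) : sexp (a :: l) = .cons (sexp a) (sexp l) := rfl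
@[simp] theorem sexp_unit (u : Unit) : sexp u = .nil := rfl
theorem sexp_nat (n : ℕ) : sexp n = sexp (encodeNat n) := rfl

theorem sz_pos (a : α) : 0 < sz a := (sexp a).size_pos
@[simp] theorem sz_mk (a : α) (b : β) : sz (a, b) = sz a + sz b + 1 := by simp [sz]
@[simp] theorem sz_nil : sz ([] : List α) = 1 := rfl
@[simp] theorem sz_cons (a : α) (l : List α) : sz (a :: l) = sz a + sz l + 1 := by simp [sz]

theorem sz_bool_le (b : Bool) : sz b ≤ 3 := by cases b <;> simp [sz]

theorem sz_append (l m : List α) : sz (l ++ m) + 1 = sz l + sz m := by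
  induction l with
  | nil => simp; omega
  | cons a l ih => simp only [List.cons_append, sz_cons]; omega

@[simp] theorem sz_reverse (l : List α) : sz l.reverse = sz l := by
  induction l with
  | nil => rfl
  | cons a l ih =>
    have := sz_append l.reverse [a]
    simp only [List.reverse_cons, sz_cons, sz_nil] at *
    omega

theorem length_lt_sz (l : List α) : l.length < sz l := by
  induction l with
  | nil => simp
  | cons a l ih => simp only [List.length_cons, sz_cons]; omega

theorem sz_drop_le (l : List α) (n : ℕ) : sz (l.drop n) ≤ sz l := by
  have := sz_append (l.take n) (l.drop n)
  rw [List.take_append_drop] at this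
  have := sz_pos (l.take n)
  omega

theorem sz_le_of_mem {l : List α} {a : α} (h : a ∈ l) : sz a ≤ sz l := by
  induction l with
  | nil => simp at h
  | cons b l ih =>
    simp only [sz_cons]
    rcases List.mem_cons.1 h with rfl | h
    · omega
    · have := ih h; omega

theorem sz_le_of_forall {l : List α} {n : ℕ} (h : ∀ a ∈ l, sz a ≤ n) :
    sz l ≤ l.length * (n + 1) + 1 := by
  induction l with
  | nil => simp
  | cons b l ih =>
    have := ih fun a ha => h a (by simp [ha])
    have := h b (by simp)
    simp only [sz_cons, List.length_cons, Nat.add_mul]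
    omega

end

/-! #### Polynomial bounds -/

/-- `g` is bounded by a polynomial in the size of its argument. -/
def PolyBdd {α : Type} [SexpRep α] (g : α → ℕ) : Prop :=
  ∃ p : Polynomial ℕ, ∀ a, g a ≤ p.eval (sz a)

theorem Polynomial.eval_mono_nat (p : Polynomial ℕ) : Monotone fun n => p.eval n := by
  intro m n h
  simp only [Polynomial.eval_eq_sum, Polynomial.sum]
  gcongr

namespace PolyBdd

variable {α β : Type} [SexpRep α] [SexpRep β]

theorem mono {g h : α → ℕ} (hh : PolyBdd h) (hg : ∀ a, g a ≤ h a) : PolyBdd g :=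
  let ⟨p, hp⟩ := hh; ⟨p, fun a => (hg a).trans (hp a)⟩

theorem const (n : ℕ) : PolyBdd fun _ : α => n := ⟨.C n, fun _ => by simp⟩

theorem size : PolyBdd fun a : α => sz a := ⟨.X, fun _ => by simp⟩

theorem add {g h : α → ℕ} (hg : PolyBdd g) (hh : PolyBdd h) : PolyBdd fun a => g a + h a :=
  let ⟨p, hp⟩ := hg; let ⟨q, hq⟩ := hh
  ⟨p + q, fun a => by simpa using add_le_add (hp a) (hq a)⟩

theorem mul {g h : α → ℕ} (hg : PolyBdd g) (hh : PolyBdd h) : PolyBdd fun a => g a * h a :=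
  let ⟨p, hp⟩ := hg; let ⟨q, hq⟩ := hh
  ⟨p * q, fun a => by simpa using Nat.mul_le_mul (hp a) (hq a)⟩

/-- A polynomial bound can be given in terms of any polynomially bounded quantity. -/
theorem of_le_eval {g h : α → ℕ} (hh : PolyBdd h) (p : Polynomial ℕ)
    (hg : ∀ a, g a ≤ p.eval (h a)) : PolyBdd g :=
  let ⟨q, hq⟩ := hh
  ⟨p.comp q, fun a => by
    rw [Polynomial.eval_comp]; exact (hg a).trans (p.eval_mono_nat (hq a))⟩

theorem comp {g : β → ℕ} {f : α → β} (hg : PolyBdd g) (hf : PolyBdd fun a => sz (f a)) :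
    PolyBdd fun a => g (f a) :=
  let ⟨p, hp⟩ := hg; hf.of_le_eval p fun a => hp (f a)

end PolyBdd

/-- `f` is computable in polynomial time. -/
@[fun_prop]
def PolyTime {α β : Type} [SexpRep α] [SexpRep β] (f : α → β) : Prop :=
  ∃ (c : RegCmd) (T : α → ℕ), PolyBdd T ∧ PolyBdd (fun a => sz (f a)) ∧ ∀ a v rest,
    c.Runs v (RegCmd.stks ((sexp a).code ++ rest)) (T a) none
      (RegCmd.stks ((sexp (f a)).code ++ rest))

namespace RegCmd

/-- Run `c`, which computes a Boolean, on a copy of the tree on top of the main stack, and keep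
its result in the internal state. -/
def test (c : RegCmd) : RegCmd :=
  .seq dup <| .seq c <| .seq (popBit .main) <|
    .ite isTrue (.seq (.pop (some .main) fun v _ => v) (.pop (some .main) fun v _ => v)) (.load id)

theorem test_runs {c : RegCmd} {x : Sexp} {b : Bool} {T : ℕ}
    (h : ∀ v rest, c.Runs v (stks (x.code ++ rest)) T none (stks ((sexp b).code ++ rest)))
    (v : Option Γ') (rest : List Bool) :
    (test c).Runs v (stks (x.code ++ rest)) (T + 30 * x.size + 40) (some (Γ'.bit b))
      (stks (x.code ++ rest)) := by
  refine ((dup_runs x rest v).seq ((h none _).seq (T' := 5) ?_)).mono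
    (show 30 * x.size + 30 + (T + 5) ≤ _ by omega)
  cases b with
  | false =>
    refine Cmd.Runs.mono (T := 1 + (1 + 1)) (Cmd.Runs.seq
      (Cmd.Runs.pop (v' := some (Γ'.bit false)) (S' := stks (x.code ++ rest)) rfl
        (by simp [stks, Sexp.code])) (.ite_false rfl (.load rfl))) (by omega)
  -- The code of `true` is `[true, false, false]`: two more bits are popped without disturbing the
  -- state, which holds the answer.
  | true =>
    refine Cmd.Runs.mono (T := 1 + (1 + 1 + 1)) (Cmd.Runs.seq
      (Cmd.Runs.pop (v' := some (Γ'.bit true)) (S' := stks (false :: false :: (x.code ++ rest)))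
        rfl (by simp [stks, Sexp.code]))
      (.ite_true rfl (.seq (.pop (S' := stks (false :: (x.code ++ rest))) rfl (by simp [stks]))
        (.pop rfl (by simp [stks]))))) (by omega)

end RegCmd

/-! ### Closure properties of polynomial time -/

namespace PolyTime

variable {α β γ τ : Type} [SexpRep α] [SexpRep β] [SexpRep γ] [SexpRep τ]

theorem sz_bdd {f : α → β} (hf : PolyTime f) : PolyBdd fun a => sz (f a) :=
  let ⟨_, _, _, h, _⟩ := hf; h

/-- A function that does not change the representation. -/
theorem of_sexp_eq {f : α → β} (h : ∀ a, sexp (f a) = sexp a) : PolyTime f :=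
  ⟨.load fun _ => none, fun _ => 1, .const 1, PolyBdd.size.mono fun a => by simp [sz, h],
    fun a v rest => h a ▸ .load rfl⟩

/-- A function with the same representation of its values as a given one. -/
theorem congr_sexp {f : α → β} {g : α → γ} (hf : PolyTime f) (h : ∀ a, sexp (g a) = sexp (f a)) :
    PolyTime g :=
  let ⟨c, T, hT, hs, hr⟩ := hf
  ⟨c, T, hT, hs.mono fun a => by simp [sz, h], fun a v rest => h a ▸ hr a v rest⟩

@[fun_prop]
theorem id' : PolyTime fun a : α => a := of_sexp_eq fun _ => rfl

@[fun_prop]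
theorem const (b : β) : PolyTime fun _ : α => b := by
  refine ⟨.seq RegCmd.drop (RegCmd.emit .main (sexp b).code), fun a => 30 * sz a + 30 + ((sexp b).size + 1),
    ?_, PolyBdd.const _, fun a v rest =>
      (RegCmd.drop_runs (sexp a) rest v).seq (RegCmd.emit_main_runs _ _ _ _ _ _)⟩
  exact (((PolyBdd.const 30).mul .size).add (.const 30)).add (.const _)

@[fun_prop]
theorem comp {g : β → γ} {f : α → β} (hg : PolyTime g) (hf : PolyTime f) :
    PolyTime fun a => g (f a) :=
  let ⟨c, T, hT, hs, hr⟩ := hf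
  let ⟨c', T', hT', hs', hr'⟩ := hg
  ⟨.seq c c', fun a => T a + T' (f a), hT.add (hT'.comp hs), hs'.comp hs,
    fun a v rest => (hr a v rest).seq (hr' (f a) none rest)⟩

-- The second component is computed first, on a copy of the argument; the swap brings the argument
-- back on top for the first component, and one bit `true` joins the two codes to that of a `cons`.
@[fun_prop]
theorem pair {f : α → β} {g : α → γ} (hf : PolyTime f) (hg : PolyTime g) :
    PolyTime fun a => (f a, g a) := by
  obtain ⟨c, T, hT, hs, hr⟩ := hf
  obtain ⟨c', T', hT', hs', hr'⟩ := hg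
  refine ⟨.seq RegCmd.dup (.seq c' (.seq RegCmd.swap (.seq c (RegCmd.pushBit .main true)))),
    fun a => (30 * sz a + 30) + (T' a + ((30 * (sz (g a) + sz a) + 30) + (T a + 1))), ?_, ?_,
    fun a v rest => (RegCmd.dup_runs _ _ v).seq ((hr' a none _).seq
      ((RegCmd.swap_runs _ _ _ none).seq ((hr a none _).seq (.push ?_))))⟩
  · have h30 : PolyBdd fun _ : α => 30 := .const 30
    exact ((h30.mul .size).add h30).add (hT'.add (((h30.mul (hs'.add .size)).add h30).add
      (hT.add (.const 1))))
  · simpa using (hs.add hs').add (.const 1)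
  · simp [RegCmd.stks, Sexp.code]

theorem car : PolyTime Sexp.car := by
  refine ⟨.seq (RegCmd.popBit .main) (.seq (.ite RegCmd.isTrue (.seq RegCmd.swap RegCmd.drop) (RegCmd.pushBit .main false))
      (.load fun _ => none)), fun a => 60 * sz a + 70,
    ((PolyBdd.const 60).mul .size).add (.const 70), PolyBdd.size.mono ?_, ?_⟩
  · intro a; cases a <;> simp [sz, Sexp.car]; omega
  · intro a v rest
    cases a with
    | nil =>
      refine ((Cmd.Runs.pop (v' := some (Γ'.bit false)) rfl rfl).seq ((Cmd.Runs.ite_false rfl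
        (.push ?_)).seq (.load rfl))).mono (show 1 + (1 + 1 + 1) ≤ _ by simp)
      simp [RegCmd.stks, Sexp.code, Sexp.car]
    | cons x y =>
      have h : Cmd.Runs (.seq RegCmd.swap RegCmd.drop) (some (Γ'.bit true))
          (RegCmd.stks (x.code ++ (y.code ++ rest))) _ none (RegCmd.stks (x.code ++ rest)) :=
        (RegCmd.swap_runs x y rest _).seq (RegCmd.drop_runs y _ none)
      refine ((Cmd.Runs.pop (v' := some (Γ'.bit true)) rfl rfl).seq ((Cmd.Runs.ite_true rfl
        (by simpa [RegCmd.stks, Sexp.code, Sexp.car] using h)).seq (.load rfl))).mono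
        (show 1 + (30 * (x.size + y.size) + 30 + (30 * y.size + 30) + 1 + 1) ≤ _ by
          simp [sz]; omega)

theorem cdr : PolyTime Sexp.cdr := by
  refine ⟨.seq (RegCmd.popBit .main) (.seq (.ite RegCmd.isTrue RegCmd.drop (RegCmd.pushBit .main false))
      (.load fun _ => none)), fun a => 60 * sz a + 70,
    ((PolyBdd.const 60).mul .size).add (.const 70), PolyBdd.size.mono ?_, ?_⟩
  · intro a; cases a <;> simp [sz, Sexp.cdr]; omega
  · intro a v rest
    cases a with
    | nil =>
      refine ((Cmd.Runs.pop (v' := some (Γ'.bit false)) rfl rfl).seq ((Cmd.Runs.ite_false rfl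
        (.push ?_)).seq (.load rfl))).mono (show 1 + (1 + 1 + 1) ≤ _ by simp)
      simp [RegCmd.stks, Sexp.code, Sexp.cdr]
    | cons x y =>
      have h := RegCmd.drop_runs x (y.code ++ rest) (some (Γ'.bit true))
      refine ((Cmd.Runs.pop (v' := some (Γ'.bit true)) rfl rfl).seq ((Cmd.Runs.ite_true rfl
        (by simpa [RegCmd.stks, Sexp.code, Sexp.cdr] using h)).seq (.load rfl))).mono
        (show 1 + (30 * x.size + 30 + 1 + 1) ≤ _ by simp [sz]; omega)

@[fun_prop]
theorem fst : PolyTime (Prod.fst : α × β → α) :=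
  ((car.comp (of_sexp_eq (f := fun a : α × β => sexp a) fun _ => rfl))).congr_sexp fun _ => rfl

@[fun_prop]
theorem snd : PolyTime (Prod.snd : α × β → β) :=
  ((cdr.comp (of_sexp_eq (f := fun a : α × β => sexp a) fun _ => rfl))).congr_sexp fun _ => rfl

/-- Is the tree a `cons`? -/
def _root_.Sexp.isCons : Sexp → Bool
  | .nil => false
  | .cons _ _ => true

theorem isCons : PolyTime Sexp.isCons := by
  refine ⟨.seq (RegCmd.popBit .main) (.seq (.ite RegCmd.isTrue (.seq RegCmd.drop (.seq RegCmd.drop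
      (RegCmd.emit .main [true, false, false]))) (RegCmd.pushBit .main false))
      (.load fun _ => none)), fun a => 60 * sz a + 70,
    ((PolyBdd.const 60).mul .size).add (.const 70), (PolyBdd.const 3).mono fun _ => sz_bool_le _,
    ?_⟩
  intro a v rest
  cases a with
  | nil =>
    refine ((Cmd.Runs.pop (v' := some (Γ'.bit false)) rfl rfl).seq ((Cmd.Runs.ite_false rfl
      (.push ?_)).seq (.load rfl))).mono (show 1 + (1 + 1 + 1) ≤ _ by simp)
    simp [RegCmd.stks, Sexp.code, Sexp.isCons]
  | cons x y =>
    have h := (RegCmd.drop_runs x (y.code ++ rest) (some (Γ'.bit true))).seq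
      ((RegCmd.drop_runs y rest none).seq
        (RegCmd.emit_main_runs [] rest (fun _ => []) [] none [true, false, false]))
    refine ((Cmd.Runs.pop (v' := some (Γ'.bit true)) rfl rfl).seq ((Cmd.Runs.ite_true rfl
      (by simpa [RegCmd.stks, Sexp.code, Sexp.isCons] using h)).seq (.load rfl))).mono
      (show 1 + (30 * x.size + 30 + (30 * y.size + 30 + 4) + 1 + 1) ≤ _ by
        simp [sz]; omega)

/-- Definition by cases, where each branch has to be computed only where it is needed. -/
theorem dite {t : α → Bool} {f : α → β} (ht : PolyTime t)
    (h1 : PolyTime fun a : { a // t a = true } => f a)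
    (h0 : PolyTime fun a : { a // t a = false } => f a) : PolyTime f := by
  obtain ⟨c, T, hT, -, hr⟩ := ht
  obtain ⟨c1, T1, ⟨p1, hp1⟩, ⟨q1, hq1⟩, hr1⟩ := h1
  obtain ⟨c0, T0, ⟨p0, hp0⟩, ⟨q0, hq0⟩, hr0⟩ := h0
  refine ⟨.seq (RegCmd.test c) (.ite RegCmd.isTrue c1 c0),
    fun a => (T a + 30 * sz a + 40) + (p1.eval (sz a) + p0.eval (sz a) + 1),
    ((hT.add ((PolyBdd.const 30).mul .size)).add (.const 40)).add
      ((PolyBdd.add ⟨p1, fun _ => le_rfl⟩ ⟨p0, fun _ => le_rfl⟩).add (.const 1)),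
    PolyBdd.mono (h := fun a => q1.eval (sz a) + q0.eval (sz a))
      (PolyBdd.add ⟨q1, fun _ => le_rfl⟩ ⟨q0, fun _ => le_rfl⟩) ?_, ?_⟩
  · intro a
    cases h : t a with
    | true => exact (hq1 ⟨a, h⟩).trans (Nat.le_add_right _ _)
    | false => exact (hq0 ⟨a, h⟩).trans (Nat.le_add_left _ _)
  · intro a v rest
    refine (RegCmd.test_runs (hr a) v rest).seq ?_
    cases h : t a with
    | true =>
      exact (Cmd.Runs.ite_true rfl (hr1 ⟨a, h⟩ _ rest)).mono
        (by have := hp1 ⟨a, h⟩; change _ ≤ p1.eval (sz a) at this; omega)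
    | false =>
      exact (Cmd.Runs.ite_false rfl (hr0 ⟨a, h⟩ _ rest)).mono
        (by have := hp0 ⟨a, h⟩; change _ ≤ p0.eval (sz a) at this; omega)

theorem coe {p : α → Prop} {f : α → β} (hf : PolyTime f) : PolyTime fun a : Subtype p => f a :=
  hf.comp (of_sexp_eq fun _ => rfl)

/-- Iteration as long as a test succeeds, with polynomial bounds on the number of rounds and on
the size of the intermediate results. -/
theorem loop {start : α → τ} {t : τ → Bool} {body : τ → τ} {n b : α → ℕ}
    (hstart : PolyTime start) (ht : PolyTime t)
    (hbody : PolyTime fun x : { x // t x = true } => body x) (hn : PolyBdd n)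
    (ht1 : ∀ a, ∀ i < n a, t (body^[i] (start a)) = true)
    (ht0 : ∀ a, t (body^[n a] (start a)) = false) (hb : PolyBdd b)
    (hsz : ∀ a, ∀ i ≤ n a, sz (body^[i] (start a)) ≤ b a) :
    PolyTime fun a => body^[n a] (start a) := by
  obtain ⟨c, T, hT, -, hr⟩ := hstart
  obtain ⟨ct, Tt, ⟨p, hp⟩, -, hrt⟩ := ht
  obtain ⟨cb, Tb, ⟨q, hq⟩, -, hrb⟩ := hbody
  -- Induction on the number `j` of rounds left after `i` rounds. Each round costs at most the
  -- bounds for body and test, evaluated at the common size bound `b a`.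
  have key : ∀ (a : α) (rest : List Bool) (j i : ℕ), i + j = n a →
      Cmd.Runs (.loop RegCmd.isTrue (.seq cb (RegCmd.test ct))) (some (Γ'.bit (t (body^[i] (start a)))))
        (RegCmd.stks ((sexp (body^[i] (start a))).code ++ rest))
        (j * (p.eval (b a) + q.eval (b a) + 30 * b a + 41) + 1) (some (Γ'.bit false))
        (RegCmd.stks ((sexp (body^[n a] (start a))).code ++ rest)) := by
    intro a rest j
    induction j with
    | zero =>
      intro i hi
      rw [Nat.add_zero] at hi
      subst hi
      rw [ht0]
      simpa using Cmd.Runs.loop_done rfl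
    | succ j ih =>
      intro i hi
      have h1 := ht1 a i (by omega)
      have ha := ih (i + 1) (by omega)
      have hx : body^[i + 1] (start a) = body (body^[i] (start a)) := iterate_succ_apply' _ _ _
      rw [hx] at ha
      have e1 : Tb ⟨body^[i] (start a), h1⟩ ≤ q.eval (b a) :=
        (hq ⟨_, h1⟩).trans (q.eval_mono_nat (hsz a i (by omega)))
      have e2 : Tt (body (body^[i] (start a))) ≤ p.eval (b a) :=
        (hp _).trans (p.eval_mono_nat (hx ▸ hsz a (i + 1) (by omega)))
      have e3 : (sexp (body (body^[i] (start a)))).size ≤ b a := hx ▸ hsz a (i + 1) (by omega)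
      rw [h1]
      refine (Cmd.Runs.loop_step rfl ((hrb ⟨_, h1⟩ _ rest).seq
        (RegCmd.test_runs (hrt (body (body^[i] (start a)))) none rest)) ha).mono ?_
      rw [Nat.add_mul]
      omega
  refine ⟨.seq c (.seq (RegCmd.test ct) (.seq (.loop RegCmd.isTrue (.seq cb (RegCmd.test ct)))
      (.load fun _ => none))),
    fun a => T a + ((p.eval (b a) + 30 * b a + 40) +
      ((n a * (p.eval (b a) + q.eval (b a) + 30 * b a + 41) + 1) + 1)), ?_,
    hb.mono fun a => hsz a _ le_rfl, fun a v rest => ?_⟩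
  · have hp' : PolyBdd fun a => p.eval (b a) := hb.of_le_eval p fun _ => le_rfl
    have hq' : PolyBdd fun a => q.eval (b a) := hb.of_le_eval q fun _ => le_rfl
    have hb' : PolyBdd fun a => 30 * b a := (PolyBdd.const 30).mul hb
    exact hT.add (((hp'.add hb').add (.const 40)).add (((hn.mul
      (((hp'.add hq').add hb').add (.const 41))).add (.const 1)).add (.const 1)))
  · refine (hr a v rest).seq (((RegCmd.test_runs (hrt (start a)) none rest).mono ?_).seq
      ((key a rest (n a) 0 (by omega)).seq (.load rfl)))
    have e1 : sz (start a) ≤ b a := hsz a 0 (by omega)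
    have e2 : Tt (start a) ≤ p.eval (b a) := (hp _).trans (p.eval_mono_nat e1)
    change _ + 30 * sz (start a) + 40 ≤ _
    omega

/-! #### Lists -/

@[fun_prop]
theorem cons {f : α → β} {l : α → List β} (hf : PolyTime f) (hl : PolyTime l) :
    PolyTime fun a => f a :: l a :=
  (hf.pair hl).congr_sexp fun _ => rfl

@[fun_prop]
theorem some' {f : α → β} (hf : PolyTime f) : PolyTime fun a => some (f a) :=
  (hf.pair (const ())).congr_sexp fun _ => rfl

@[fun_prop]
theorem tail {l : α → List β} (hl : PolyTime l) : PolyTime fun a => (l a).tail :=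
  (cdr.comp (hl.congr_sexp (g := fun a => sexp (l a)) fun _ => rfl)).congr_sexp fun a => by
    cases l a <;> rfl

theorem headD {l : α → List β} (hl : PolyTime l) (d : β) (hd : sexp d = .nil) :
    PolyTime fun a => (l a).headD d :=
  (car.comp (hl.congr_sexp (g := fun a => sexp (l a)) fun _ => rfl)).congr_sexp fun a => by
    cases l a <;> simp [hd, Sexp.car]

@[fun_prop]
theorem head? {l : α → List β} (hl : PolyTime l) : PolyTime fun a => (l a).head? := by
  have ht : PolyTime fun a => Sexp.isCons (sexp (l a)) :=
    isCons.comp (hl.congr_sexp fun _ => rfl)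
  refine ht.dite ?_ ?_
  · have h : PolyTime fun a => (Sexp.car (sexp (l a)), ()) :=
      (car.comp (hl.congr_sexp (g := fun a => sexp (l a)) fun _ => rfl)).pair (const ())
    refine (h.coe (p := fun a => (sexp (l a)).isCons = true)).congr_sexp fun a => ?_
    obtain ⟨a, ha⟩ := a
    change sexp (l a).head? = sexp (Sexp.car (sexp (l a)), ())
    cases h : l a <;> simp [h, Sexp.isCons, Sexp.car] at ha ⊢
  · refine (const (none : Option β)).congr_sexp fun a => ?_
    obtain ⟨a, ha⟩ := a
    change sexp (l a).head? = .nil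
    cases h : l a <;> simp [h, Sexp.isCons] at ha ⊢

/-- A program has no closures, so the loop carries the parameter `a` along with the remaining list
and the accumulator. The size bound is needed only for the folds over prefixes, which are the
intermediate accumulators. -/
theorem foldl {l : α → List β} {i : α → γ} {s : α → γ → β → γ} {b : α → ℕ}
    (hl : PolyTime l) (hi : PolyTime i) (hs : PolyTime fun q : α × γ × β => s q.1 q.2.1 q.2.2)
    (hb : PolyBdd b) (hsz : ∀ a, ∀ l', l' <+: l a → sz (l'.foldl (s a) (i a)) ≤ b a) :
    PolyTime fun a => (l a).foldl (s a) (i a) := by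
  let body : α × List β × γ → α × List β × γ := fun x => match x.2.1 with
    | [] => x
    | y :: l => (x.1, l, s x.1 x.2.2 y)
  have hiter : ∀ (a : α) (n : ℕ) (l : List β) (c : γ),
      body^[n] (a, l, c) = (a, l.drop n, (l.take n).foldl (s a) c) := by
    intro a n
    induction n with
    | zero => simp
    | succ n ih => intro l c; cases l <;> simp [body, ih]
  let t : α × List β × γ → Bool := fun x => Sexp.isCons (sexp x.2.1)
  have ht' : ∀ a l c, t (a, l, c) = !l.isEmpty := by intro a l c; cases l <;> rfl
  have ht : PolyTime t := isCons.comp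
    (congr_sexp (f := fun x : α × List β × γ => x.2.1) (by fun_prop) fun _ => rfl)
  have hbody : PolyTime fun x : { x // t x = true } => body x := by
    have h1 : PolyTime fun x : { x // t x = true } => x.1.1 :=
      coe (p := fun x => t x = true) (f := fun x => x.1) (by fun_prop)
    have h2 : PolyTime fun x : { x // t x = true } => x.1.2.1 :=
      coe (p := fun x => t x = true) (f := fun x => x.2.1) (by fun_prop)
    have h3 : PolyTime fun x : { x // t x = true } => x.1.2.2 :=
      coe (p := fun x => t x = true) (f := fun x => x.2.2) (by fun_prop)
    -- `β` need not have an element to serve as default, so the head is taken only on the subtype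
    -- where the test guarantees a nonempty list.
    have h4 : PolyTime fun x : { x // t x = true } =>
        x.1.2.1.head (by
          obtain ⟨⟨a, l, c⟩, hx⟩ := x
          rw [ht'] at hx
          simpa using hx) :=
      (car.comp (h2.congr_sexp (g := fun x => sexp x.1.2.1) fun _ => rfl)).congr_sexp fun x => by
        obtain ⟨⟨a, l, c⟩, hx⟩ := x
        rw [ht'] at hx
        cases l <;> simp at hx ⊢
        rfl
    refine congr_sexp (h1.pair (h2.tail.pair (hs.comp (h1.pair (h3.pair h4))))) fun x => ?_
    obtain ⟨⟨a, l, c⟩, hx⟩ := x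
    rw [ht'] at hx
    cases l <;> simp at hx ⊢
    rfl
  have := loop (start := fun a => (a, l a, i a)) (n := fun a => (l a).length)
    (b := fun a => sz a + (sz (l a) + b a + 1) + 1) (by fun_prop) ht hbody
    (hl.sz_bdd.mono fun a => (length_lt_sz _).le)
    (fun a i hi => by simp [hiter, ht', hi]) (fun a => by simp [hiter, ht'])
    ((PolyBdd.size.add ((hl.sz_bdd.add hb).add (.const 1))).add (.const 1))
    (fun a n _ => by
      have := sz_drop_le (l a) n
      have := hsz a ((l a).take n) (List.take_prefix _ _)
      simp only [hiter, sz_mk]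
      omega)
  have h2 : PolyTime fun a => (body^[(l a).length] (a, l a, i a)).2.2 :=
    (snd.comp (snd.comp this))
  simpa [hiter] using h2

/-- Folds each of whose steps adds a bounded amount to the size of the result. -/
theorem foldl_of_growth {l : α → List β} {i : α → γ} {s : α → γ → β → γ} (g : α → β → ℕ)
    (hl : PolyTime l) (hi : PolyTime i) (hs : PolyTime fun q : α × γ × β => s q.1 q.2.1 q.2.2)
    (hg : PolyBdd fun q : α × β => g q.1 q.2)
    (h : ∀ a c, ∀ x ∈ l a, sz (s a c x) ≤ sz c + g a x) :
    PolyTime fun a => (l a).foldl (s a) (i a) := by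
  obtain ⟨p, hp⟩ := hg
  refine foldl hl hi hs (b := fun a => sz (i a) + sz (l a) * p.eval (sz a + sz (l a) + 1))
    (hi.sz_bdd.add (hl.sz_bdd.mul (((PolyBdd.size.add hl.sz_bdd).add (.const 1)).of_le_eval p
      fun _ => le_rfl))) ?_
  intro a l' hl'
  have key : ∀ (l' : List β), (∀ x ∈ l', x ∈ l a) → ∀ c, sz (l'.foldl (s a) c) ≤
      sz c + l'.length * p.eval (sz a + sz (l a) + 1) := by
    intro l'
    induction l' with
    | nil => simp
    | cons x l' ih =>
      intro hl' c
      have h1 := ih (fun y hy => hl' y (by simp [hy])) (s a c x)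
      have h2 := h a c x (hl' x (by simp))
      have h3 : g a x ≤ p.eval (sz a + sz (l a) + 1) :=
        (hp (a, x)).trans (p.eval_mono_nat (by
          have := sz_le_of_mem (hl' x (by simp))
          simp only [sz_mk]; omega))
      simp only [List.foldl_cons, List.length_cons, Nat.add_mul]
      omega
  refine (key l' (fun x hx => hl'.subset hx) _).trans ?_
  gcongr
  exact hl'.length_le.trans (length_lt_sz _).le

end PolyTime

end PolyTime

/-! ### Library of polynomial-time functions on Booleans, lists and binary numbers -/

section PolyTimeFunctions

open Turing Function SexpRep

namespace PolyTime

variable {α β γ : Type} [SexpRep α] [SexpRep β] [SexpRep γ]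

/-! #### Booleans -/

@[fun_prop]
theorem cond {c : α → Bool} {f g : α → β} (hc : PolyTime c) (hf : PolyTime f) (hg : PolyTime g) :
    PolyTime fun a => bif c a then f a else g a :=
  hc.dite ((hf.coe (p := fun a => c a = true)).congr_sexp fun a => by simp [a.2])
    ((hg.coe (p := fun a => c a = false)).congr_sexp fun a => by simp [a.2])

@[fun_prop]
theorem not {c : α → Bool} (hc : PolyTime c) : PolyTime fun a => !c a :=
  (hc.cond (const false) (const true)).congr_sexp fun a => by cases c a <;> rfl

@[fun_prop]
theorem and {c d : α → Bool} (hc : PolyTime c) (hd : PolyTime d) : PolyTime fun a => c a && d a :=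
  (hc.cond hd (const false)).congr_sexp fun a => by cases c a <;> rfl

@[fun_prop]
theorem or {c d : α → Bool} (hc : PolyTime c) (hd : PolyTime d) : PolyTime fun a => c a || d a :=
  (hc.cond (const true) hd).congr_sexp fun a => by cases c a <;> rfl

@[fun_prop]
theorem xor {c d : α → Bool} (hc : PolyTime c) (hd : PolyTime d) :
    PolyTime fun a => (c a).xor (d a) :=
  (hc.cond hd.not hd).congr_sexp fun a => by cases c a <;> cases d a <;> rfl

/-! #### Lists -/

@[fun_prop]
theorem toSexp {f : α → β} (hf : PolyTime f) : PolyTime fun a => sexp (f a) :=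
  hf.congr_sexp fun _ => rfl

@[fun_prop]
theorem isEmpty {l : α → List β} (hl : PolyTime l) : PolyTime fun a => (l a).isEmpty :=
  (isCons.comp hl.toSexp).not.congr_sexp fun a => by cases l a <;> rfl

@[fun_prop]
theorem toList {o : α → Option β} (ho : PolyTime o) : PolyTime fun a => (o a).toList :=
  ho.congr_sexp fun a => by cases o a <;> rfl

@[fun_prop]
theorem reverse {l : α → List β} (hl : PolyTime l) : PolyTime fun a => (l a).reverse := by
  have := foldl_of_growth (l := l) (i := fun _ => ([] : List β)) (s := fun _ m x => x :: m)
    (fun _ x => sz x + 1) hl (const _) (by fun_prop)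
    (snd.sz_bdd.add (.const 1)) (fun a c x _ => by simp; omega)
  simpa using this

@[fun_prop]
theorem append {l m : α → List β} (hl : PolyTime l) (hm : PolyTime m) :
    PolyTime fun a => l a ++ m a := by
  have := foldl_of_growth (l := fun a => (l a).reverse) (i := m) (s := fun _ m x => x :: m)
    (fun _ x => sz x + 1) hl.reverse hm (by fun_prop)
    (snd.sz_bdd.add (.const 1)) (fun a c x _ => by simp; omega)
  simpa using this

@[fun_prop]
theorem flatMap {l : α → List β} {f : α → β → List γ} (hl : PolyTime l)
    (hf : PolyTime fun q : α × β => f q.1 q.2) : PolyTime fun a => (l a).flatMap (f a) := by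
  have := (foldl_of_growth (l := l) (i := fun _ => ([] : List γ))
    (s := fun a m x => (f a x).reverse ++ m)
    (fun a x => sz (f a x)) hl (const _)
    (append (reverse (hf.comp (f := fun q : α × List γ × β => (q.1, q.2.2)) (by fun_prop)))
      (by fun_prop)) hf.sz_bdd (fun a c x _ => by
        have := sz_append (f a x).reverse c
        rw [sz_reverse] at this
        omega)).reverse
  have key : ∀ a (l : List β) m,
      l.foldl (fun m x => (f a x).reverse ++ m) m = (l.flatMap (f a)).reverse ++ m := by
    intro a l
    induction l <;> simp_all
  simpa [key] using this

@[fun_prop]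
theorem map {l : α → List β} {f : α → β → γ} (hl : PolyTime l)
    (hf : PolyTime fun q : α × β => f q.1 q.2) : PolyTime fun a => (l a).map (f a) := by
  simpa [List.map_eq_flatMap] using
    flatMap (f := fun a x => [f a x]) hl (hf.cons (const []))

@[fun_prop]
theorem filter {l : α → List β} {p : α → β → Bool} (hl : PolyTime l)
    (hp : PolyTime fun q : α × β => p q.1 q.2) : PolyTime fun a => (l a).filter (p a) := by
  have := flatMap (f := fun a x => bif p a x then [x] else []) hl
    (hp.cond (by fun_prop) (const []))
  refine this.congr_sexp fun a => ?_
  congr 1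
  induction l a with
  | nil => rfl
  | cons x l ih => cases h : p a x <;> simp [h, ih]

@[fun_prop]
theorem any {l : α → List β} {p : α → β → Bool} (hl : PolyTime l)
    (hp : PolyTime fun q : α × β => p q.1 q.2) : PolyTime fun a => (l a).any (p a) :=
  (hl.filter hp).isEmpty.not.congr_sexp fun a => by
    congr 1
    induction l a with
    | nil => rfl
    | cons x l ih => cases h : p a x <;> simp [h, ih]

/-- Drop as many entries as another list has. -/
@[fun_prop]
theorem drop_length {l : α → List β} {m : α → List γ} (hl : PolyTime l) (hm : PolyTime m) :
    PolyTime fun a => (l a).drop (m a).length := by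
  have := foldl_of_growth (l := m) (i := l) (s := fun _ l _ => l.tail)
    (fun _ _ => 0) hm hl (by fun_prop) (.const 0) (fun a c x _ => by
      have := sz_drop_le c 1
      simpa using this)
  have key : ∀ (m : List γ) (l : List β), m.foldl (fun l _ => l.tail) l = l.drop m.length := by
    intro m
    induction m with
    | nil => simp
    | cons x m ih => intro l; cases l <;> simp [ih]
  simpa [key] using this

theorem drop {l : α → List β} (hl : PolyTime l) (n : ℕ) : PolyTime fun a => (l a).drop n := by
  simpa using drop_length (m := fun _ : α => List.replicate n ()) hl (const _)

theorem take {l : α → List β} (hl : PolyTime l) (n : ℕ) : PolyTime fun a => (l a).take n := by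
  induction n generalizing l with
  | zero => simpa using const (α := α) ([] : List β)
  | succ n ih =>
    refine (append hl.head?.toList (ih hl.tail)).congr_sexp fun a => ?_
    cases l a <;> simp

/-! #### Equality -/

/-- The code of a tree. -/
theorem code : PolyTime Sexp.code := by
  -- The code lies reversed on the auxiliary stack, so the list is built from its end: `false` is
  -- the code of `[]`, and each bit contributes its own code and the mark of a `cons`.
  refine ⟨.seq (RegCmd.moveTree true) (.seq (RegCmd.pushBit .main false)
    (RegCmd.drain (some (.aux true)) Γ'.bit (.seq (.ite RegCmd.isTrue
      (RegCmd.emit .main [true, false, false]) (RegCmd.emit .main [false]))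
      (RegCmd.pushBit .main true)))), fun x => (8 * sz x + 3) + (1 + (8 * sz x + 2)),
    ((((PolyBdd.const 8).mul .size).add (.const 3)).add
      ((PolyBdd.const 1).add (((PolyBdd.const 8).mul .size).add (.const 2)))),
    (((PolyBdd.const 4).mul .size).add (.const 1)).mono fun x => ?_, fun x v rest => ?_⟩
  · refine (sz_le_of_forall (n := 3) fun b _ => sz_bool_le b).trans ?_
    simp [sz, Sexp.size, mul_comm]
  · have h1 := RegCmd.moveTree_runs true [] (fun _ => []) x rest v
    have h2 := RegCmd.drain_runs (k := some (.aux true)) (g := Γ'.bit)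
      (c := .seq (.ite RegCmd.isTrue
      (RegCmd.emit .main [true, false, false]) (RegCmd.emit .main [false]))
      (RegCmd.pushBit .main true)) (T := 6)
      (fun l (m : List Bool) =>
        regs [] ((sexp m).code ++ rest) (update (fun _ => []) true l) []) (fun m b => b :: m)
      (by simp) (by simp) (fun b l a => by
        cases b with
        | true =>
          exact ⟨_, (((Cmd.Runs.ite_true rfl (RegCmd.emit_main_runs _ _ _ _ _ _)).seq
            (.push (by simp [Sexp.code]))).mono (show 4 + 1 + 1 ≤ 6 by omega))⟩
        | false =>
          exact ⟨_, (((Cmd.Runs.ite_false rfl (RegCmd.emit_main_runs _ _ _ _ _ _)).seq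
            (.push (by simp [Sexp.code]))).mono (show 2 + 1 + 1 ≤ 6 by omega))⟩)
      x.code.reverse [] none
    have e2 : update (fun _ => []) true [] = (fun _ => ([] : List Bool)) := by
      funext d; cases d <;> simp
    refine (h1.seq ((Cmd.Runs.push rfl).seq (T' := 8 * sz x + 2) ?_))
    simpa [e2, Sexp.code, sz, Sexp.size, RegCmd.stks] using h2

end PolyTime

theorem Sexp.code_append_inj : ∀ {x y : Sexp} {v w : List Bool},
    x.code ++ v = y.code ++ w → x = y ∧ v = w
  | nil, nil, v, w, h => by simpa [code] using h
  | nil, cons _ _, v, w, h => by simp [code] at h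
  | cons _ _, nil, v, w, h => by simp [code] at h
  | cons x x', cons y y', v, w, h => by
    simp only [code, List.cons_append, List.append_assoc, List.cons.injEq, true_and] at h
    obtain ⟨h1, h⟩ := code_append_inj h
    obtain ⟨h2, h⟩ := code_append_inj h
    exact ⟨by rw [h1, h2], h⟩

theorem Sexp.code_injective : Injective Sexp.code := fun x y h =>
  (code_append_inj (v := []) (w := []) (by simpa using h)).1

/-- Different elements have different representations. -/
class SexpInj (α : Type) [SexpRep α] : Prop where
  inj : Injective (sexp : α → Sexp)

section
variable {α β : Type} [SexpRep α] [SexpRep β]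

theorem sexp_inj [SexpInj α] {a b : α} : sexp a = sexp b ↔ a = b := SexpInj.inj.eq_iff

instance : SexpInj Bool := ⟨fun a b h => by cases a <;> cases b <;> simp at h ⊢⟩
instance [SexpInj α] [SexpInj β] : SexpInj (α × β) :=
  ⟨fun a b h => by
    obtain ⟨a, a'⟩ := a; obtain ⟨b, b'⟩ := b
    simpa [sexp_inj] using h⟩
instance [SexpInj α] : SexpInj (Option α) :=
  ⟨fun a b h => by cases a <;> cases b <;> simp_all [sexp_inj]⟩
instance [SexpInj α] : SexpInj (List α) :=
  ⟨fun a => by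
    induction a with
    | nil => intro b h; cases b <;> simp at h ⊢
    | cons x a ih =>
      intro b h
      cases b with
      | nil => simp at h
      | cons y b =>
        simp only [sexp_cons, Sexp.cons.injEq, sexp_inj] at h
        rw [h.1, ih h.2]⟩
instance : SexpInj ℕ := ⟨fun a b h => by
  rw [sexp_nat, sexp_nat, sexp_inj] at h
  rw [← decode_encodeNat a, h, decode_encodeNat]⟩

end

namespace PolyTime

variable {α β γ : Type} [SexpRep α] [SexpRep β] [SexpRep γ]

/-- The fold over the first list consumes the second in parallel and keeps a flag; the lists agree
when the flag survives and the second list is used up. -/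
theorem beq_listBool : PolyTime fun q : List Bool × List Bool => q.1 == q.2 := by
  have h1 := foldl_of_growth (l := fun q : List Bool × List Bool => q.1)
    (i := fun q => (true, q.2))
    (s := fun _ c b => (c.1 && !c.2.isEmpty && !b.xor (c.2.headD false), c.2.tail))
    (fun _ _ => 2) (by fun_prop) (by fun_prop)
    (pair (and (by fun_prop) (not (xor (by fun_prop) (headD (by fun_prop) _ rfl))))
      (by fun_prop)) (.const 2) (fun a c x _ => by
        have h1 := sz_drop_le c.2 1
        rw [List.drop_one] at h1
        have h2 := sz_bool_le (c.1 && !c.2.isEmpty && !x.xor (c.2.headD false))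
        have h3 : sz c = sz c.1 + sz c.2 + 1 := sz_mk _ _
        have := sz_pos c.1
        simp only [sz_mk]
        omega)
  refine ((fst.comp h1).and (isEmpty (snd.comp h1))).congr_sexp fun q => ?_
  have key : ∀ (l m : List Bool) (ok : Bool),
      ((l.foldl (fun c b => (c.1 && !c.2.isEmpty && !b.xor (c.2.headD false), c.2.tail))
        (ok, m)).1 && (l.foldl (fun c b => (c.1 && !c.2.isEmpty && !b.xor (c.2.headD false),
          c.2.tail)) (ok, m)).2.isEmpty) = (ok && (l == m)) := by
    intro l
    induction l with
    | nil => intro m ok; cases m <;> simp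
    | cons b l ih =>
      intro m ok
      rw [List.foldl_cons, ih]
      cases m with
      | nil => simp
      | cons b' m => cases b <;> cases b' <;> simp [Bool.beq_eq_decide_eq]
  rw [key]
  rfl

-- Codes of trees are injective, so every equality test reduces to comparing two lists of bits.
@[fun_prop]
theorem beq [SexpInj β] [BEq β] [LawfulBEq β] {f g : α → β} (hf : PolyTime f) (hg : PolyTime g) :
    PolyTime fun a => f a == g a := by
  refine (beq_listBool.comp ((code.comp hf.toSexp).pair (code.comp hg.toSexp))).congr_sexp
    fun a => ?_
  congr 1
  rw [Bool.eq_iff_iff]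
  simp [Sexp.code_injective.eq_iff, sexp_inj]

/-! #### Natural numbers -/

end PolyTime

theorem encodeNat_eq_bits (n : ℕ) : encodeNat n = n.bits := by
  have h : ∀ p : PosNum, encodePosNum p = (p : ℕ).bits := by
    intro p
    induction p with
    | one => simp [encodePosNum]
    | bit0 p ih =>
      rw [encodePosNum, ih, PosNum.cast_bit0, ← two_mul, Nat.bit0_bits]
      exact (PosNum.cast_pos p).ne'
    | bit1 p ih =>
      rw [encodePosNum, ih, PosNum.cast_bit1, ← two_mul, Nat.bit1_bits]
  have h2 : ∀ m : Num, encodeNum m = (m : ℕ).bits := by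
    intro m
    cases m with
    | zero => simp [encodeNum]
    | pos p => simpa [encodeNum] using h p
  rw [encodeNat, h2, Num.to_of_nat]

theorem sexp_nat_eq (n : ℕ) : sexp n = sexp n.bits := by rw [sexp_nat, encodeNat_eq_bits]

theorem sz_nat_le (n : ℕ) : sz n ≤ 4 * n.size + 1 := by
  have := sz_le_of_forall (l := n.bits) (n := 3) fun b _ => sz_bool_le b
  rw [← Nat.size_eq_bits_len]
  simpa [sz, sexp_nat_eq, mul_comm] using this

theorem size_lt_sz (n : ℕ) : n.size < sz n := by
  rw [← Nat.size_eq_bits_len, sz, sexp_nat_eq]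
  exact length_lt_sz _

/-- For positive `m` and `n` both powers are at least `2`, and then `2 ^ a + 2 ^ b ≤ 2 ^ a * 2 ^ b`;
zero is treated apart. This crude bound suffices to keep partial sums of a list linear in the size
of the list. -/
theorem Nat.size_add_le (m n : ℕ) : (m + n).size ≤ m.size + n.size := by
  rw [Nat.size_le, pow_add]
  have hm := Nat.lt_size_self m
  have hn := Nat.lt_size_self n
  rcases Nat.eq_zero_or_pos m with rfl | h1
  · simpa using hn
  rcases Nat.eq_zero_or_pos n with rfl | h2
  · simpa using hm
  have h1' : 1 ≤ m.size := Nat.size_pos.2 h1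
  have h2' : 1 ≤ n.size := Nat.size_pos.2 h2
  have e1 : 2 ^ 1 ≤ 2 ^ m.size := Nat.pow_le_pow_right (by omega) h1'
  have e2 : 2 ^ 1 ≤ 2 ^ n.size := Nat.pow_le_pow_right (by omega) h2'
  nlinarith

theorem Nat.size_sum_le (l : List ℕ) : l.sum.size ≤ sz l := by
  induction l with
  | nil => simp
  | cons a l ih =>
    have := Nat.size_add_le a l.sum
    have := size_lt_sz a
    simp only [List.sum_cons, sz_cons]
    omega

theorem Nat.bits_of_ne_zero {n : ℕ} (h : n ≠ 0) : n.bits = n.bodd :: n.div2.bits := by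
  conv_lhs => rw [← Nat.bit_bodd_div2 n]
  refine Nat.bits_append_bit _ _ fun h0 => ?_
  have := Nat.bit_bodd_div2 n
  rw [h0] at this
  cases hb : n.bodd with
  | true => rfl
  | false => rw [hb] at this; simp at this; omega

theorem Nat.bits_tail (n : ℕ) : n.bits.tail = n.div2.bits := by
  rcases eq_or_ne n 0 with rfl | h
  · simp
  · rw [Nat.bits_of_ne_zero h, List.tail_cons]

theorem Nat.bits_headD (n : ℕ) : n.bits.headD false = n.bodd := by
  rcases eq_or_ne n 0 with rfl | h
  · simp
  · rw [Nat.bits_of_ne_zero h, List.headD_cons]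

namespace PolyTime

variable {α β γ : Type} [SexpRep α] [SexpRep β] [SexpRep γ]

/-- One step of the addition of two numbers in binary, with carry `c.1`. -/
def _root_.addStep (c : Bool × List Bool × List Bool × List Bool) :
    Bool × List Bool × List Bool × List Bool :=
  bif c.2.1.isEmpty && c.2.2.1.isEmpty then c
  else
    (bif c.1 then c.2.1.headD false || c.2.2.1.headD false
      else c.2.1.headD false && c.2.2.1.headD false,
    c.2.1.tail, c.2.2.1.tail,
    (c.1.xor ((c.2.1.headD false).xor (c.2.2.1.headD false))) :: c.2.2.2)

/-- The list `l` is only a clock, at least as long as both numbers. The invariant is that the output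
so far, followed by the bits of the remaining sum with carry, stays the same. Once both numbers are
used up the step is idle, so no superfluous high zeros appear, and a last carry becomes the top bit.
-/
theorem addStep_foldl (l : List Bool) : ∀ (x y : ℕ) (c : Bool) (o : List Bool),
    x.size ≤ l.length → y.size ≤ l.length →
    (l.foldl (fun c _ => addStep c) (c, x.bits, y.bits, o)).2.2.2.reverse ++
      (bif (l.foldl (fun c _ => addStep c) (c, x.bits, y.bits, o)).1 then [true] else []) =
    o.reverse ++ (x + y + c.toNat).bits := by
  induction l with
  | nil =>
    intro x y c o hx hy
    obtain rfl : x = 0 := Nat.size_eq_zero.1 (by simpa using hx)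
    obtain rfl : y = 0 := Nat.size_eq_zero.1 (by simpa using hy)
    cases c <;> simp
  | cons b l ih =>
    intro x y c o hx hy
    rw [List.foldl_cons]
    by_cases h : x = 0 ∧ y = 0
    · obtain ⟨rfl, rfl⟩ := h
      simpa [addStep] using ih 0 0 c o (by simp) (by simp)
    · have he : (x.bits.isEmpty && y.bits.isEmpty) = false := by
        rw [Bool.eq_false_iff]
        simp only [ne_eq, Bool.and_eq_true, List.isEmpty_iff, ← List.length_eq_zero_iff,
          Nat.size_eq_bits_len, Nat.size_eq_zero]
        exact h
      have hs : ∀ z : ℕ, z.size ≤ (b :: l).length → z.div2.size ≤ l.length := by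
        intro z hz
        rw [← Nat.size_eq_bits_len] at hz ⊢
        rw [← Nat.bits_tail]
        simp at hz ⊢
        omega
      have hstep : addStep (c, x.bits, y.bits, o) =
          (bif c then x.bodd || y.bodd else x.bodd && y.bodd, x.div2.bits, y.div2.bits,
            (c.xor (x.bodd.xor y.bodd)) :: o) := by
        simp only [addStep, he, cond_false, Nat.bits_tail, Nat.bits_headD]
      rw [hstep, ih _ _ _ _ (hs x hx) (hs y hy), Nat.bits_of_ne_zero (n := x + y + c.toNat) (by omega)]
      simp only [List.reverse_cons, List.append_assoc, List.singleton_append]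
      have hx2 := Nat.bodd_add_div2 x
      have hy2 := Nat.bodd_add_div2 y
      have hs2 := Nat.bodd_add_div2 (x + y + c.toNat)
      congr 2
      · simp only [Nat.bodd_add]
        cases c <;> cases x.bodd <;> cases y.bodd <;> rfl
      · congr 1
        revert hs2
        simp only [Nat.bodd_add]
        revert hx2 hy2
        cases c <;> cases x.bodd <;> cases y.bodd <;> simp <;> omega

theorem addStep' : PolyTime addStep := by
  have h1 : PolyTime fun c : Bool × List Bool × List Bool × List Bool => c.2.1.headD false :=
    headD (by fun_prop) _ rfl
  have h2 : PolyTime fun c : Bool × List Bool × List Bool × List Bool => c.2.2.1.headD false :=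
    headD (by fun_prop) _ rfl
  exact cond (by fun_prop) (by fun_prop) (pair (cond (by fun_prop) (or h1 h2) (and h1 h2))
    (pair (by fun_prop) (pair (by fun_prop) (cons (xor (by fun_prop) (xor h1 h2)) (by fun_prop)))))

@[fun_prop]
theorem add {f g : α → ℕ} (hf : PolyTime f) (hg : PolyTime g) : PolyTime fun a => f a + g a := by
  have hf' : PolyTime fun a => (f a).bits := hf.congr_sexp fun a => (sexp_nat_eq _).symm
  have hg' : PolyTime fun a => (g a).bits := hg.congr_sexp fun a => (sexp_nat_eq _).symm
  -- The concatenation of both bit lists is a sufficiently long clock; its entries are ignored.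
  have h := foldl_of_growth (l := fun a => (f a).bits ++ (g a).bits)
    (i := fun a => (false, (f a).bits, (g a).bits, ([] : List Bool)))
    (s := fun _ c _ => addStep c) (fun _ _ => 10) (by fun_prop) (by fun_prop)
    (addStep'.comp (by fun_prop)) (.const 10) (fun a c x _ => by
      obtain ⟨c, x, y, o⟩ := c
      rw [addStep]
      cases x.isEmpty && y.isEmpty with
      | true => simp
      | false =>
        have h1 := sz_drop_le x 1
        have h2 := sz_drop_le y 1
        rw [List.drop_one] at h1 h2
        have h3 := sz_bool_le (bif c then x.headD false || y.headD false
          else x.headD false && y.headD false)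
        have h4 := sz_bool_le (c.xor ((x.headD false).xor (y.headD false)))
        simp only [cond_false, sz_mk, sz_cons]
        omega)
  refine (append (reverse (snd.comp (snd.comp (snd.comp h))))
    (cond (fst.comp h) (const [true]) (const []))).congr_sexp fun a => ?_
  rw [addStep_foldl, sexp_nat_eq]
  · simp
  · simp [Nat.size_eq_bits_len]
  · simp [Nat.size_eq_bits_len]

@[fun_prop]
theorem sum {l : α → List ℕ} (hl : PolyTime l) : PolyTime fun a => (l a).sum := by
  -- The bit length of a partial sum is at most the size of the prefix summed, which bounds all
  -- intermediate results at once.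
  have := foldl (l := l) (i := fun _ => 0) (s := fun _ c x => c + x) (b := fun a => 4 * sz (l a) + 1)
    hl (const 0) (by fun_prop) (((PolyBdd.const 4).mul hl.sz_bdd).add (.const 1)) (fun a l' hl' => by
      rw [← List.sum_eq_foldl]
      obtain ⟨m, hm⟩ := hl'
      have h1 := sz_nat_le l'.sum
      have h2 := Nat.size_sum_le l'
      have h3 := sz_append l' m
      have h4 := sz_pos m
      rw [hm] at h3
      omega)
  simpa only [← List.sum_eq_foldl] using this

end PolyTime

end PolyTimeFunctions

/-! ### Input and output of the machine; reading the words of instances -/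

section InputOutput

open Turing Function SexpRep

instance : SexpRep Γ' := ⟨fun t => match t with
  | .blank => .nil
  | .bit false => .cons .nil .nil
  | .bit true => .cons .nil (.cons .nil .nil)
  | .bra => .cons (.cons .nil .nil) .nil
  | .ket => .cons (.cons .nil .nil) (.cons .nil .nil)
  | .comma => .cons .nil (.cons .nil (.cons .nil .nil))⟩

instance : SexpInj Γ' := ⟨fun a b h => by
  rcases a with _ | (_ | _) | _ | _ | _ <;> rcases b with _ | (_ | _) | _ | _ | _ <;>
    first | rfl | simp [sexp] at h⟩

theorem sz_symbol_le (t : Γ') : sz t ≤ 7 := by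
  rcases t with _ | (_ | _) | _ | _ | _ <;> simp [sz, sexp]

namespace RegCmd

/-- Push the code of the symbol held by the internal state. -/
def emitSymbol : List Γ' → RegCmd
  | [] => .load id
  | t :: l => .ite (fun v => decide (v = some t))
      (emit (.aux true) (true :: (sexp t).code).reverse) (emitSymbol l)

theorem emitSymbol_runs (i : List Γ') (m : List Bool) (x : Bool → List Bool) (n : List Bool)
    (t : Γ') (l : List Γ') (ht : t ∈ l) :
    Cmd.Runs (emitSymbol l) (some t) (regs i m x n) (l.length + 10) (some t)
      (regs i m (update x true ((true :: (sexp t).code).reverse ++ x true)) n) := by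
  induction l with
  | nil => simp at ht
  | cons u l ih =>
    by_cases h : t = u
    · subst h
      refine (Cmd.Runs.ite_true (by simp) (emit_aux_runs true i m x n _ _)).mono ?_
      have := sz_symbol_le t
      simp only [sz, Sexp.size] at this
      simp
      omega
    · refine (Cmd.Runs.ite_false (by simpa using h) (ih (by simpa [h] using ht))).mono ?_
      simp

/-- Turn the word on the input stack into the tree that represents it. -/
def read : RegCmd :=
  .seq (drain none id (emitSymbol [.blank, .bit false, .bit true, .bra, .ket, .comma]))
    (.seq (pushBit (.aux true) false) (pourMain true))

theorem read_runs (w : List Γ') (v : Option Γ') :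
    Cmd.Runs read v (regs w [] (fun _ => []) []) (18 * w.length + 3 * sz w + 5) none
      (stks (sexp w).code) := by
  have h1 := drain_runs (k := none) (g := id)
    (c := emitSymbol [.blank, .bit false, .bit true, .bra, .ket, .comma]) (T := 16)
    (fun l (m : List Bool) => regs l [] (update (fun _ => []) true m) [])
    (fun m t => (true :: (sexp t).code).reverse ++ m) (by simp) (by simp)
    (fun t l m => ⟨_, by
      simpa using emitSymbol_runs l [] (update (fun _ => []) true m) [] t
        [.blank, .bit false, .bit true, .bra, .ket, .comma]
        (by rcases t with _ | (_ | _) | _ | _ | _ <;> simp)⟩) w [] v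
  have key : ∀ (w : List Γ') (m : List Bool),
      false :: w.foldl (fun m t => (true :: (sexp t).code).reverse ++ m) m =
        (sexp w).code.reverse ++ m := by
    intro w
    induction w with
    | nil => simp [Sexp.code]
    | cons t w ih => intro m; rw [List.foldl_cons, ih]; simp [Sexp.code]
  have h2 := pourMain_runs true [] [] (update (fun _ => []) true (sexp w).code.reverse) [] none
  have e1 : update (fun _ => []) true [] = (fun _ => ([] : List Bool)) := by
    funext d; cases d <;> simp
  simp only [e1, update_self, List.reverse_reverse, List.append_nil, List.length_reverse,
    update_idem] at h1 h2
  refine (h1.seq ((Cmd.Runs.push ?_).seq h2)).mono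
    (show (16 + 2) * w.length + 2 + (1 + (3 * sz w + 2)) ≤ _ by omega)
  rw [update_regs_aux, regs_aux, update_self, key, update_idem, List.append_nil]

/-- Turn the tree on the main stack, which represents a list of bits, into this list. -/
def write : RegCmd :=
  .seq (popBit .main) <| .seq (.loop isTrue <| .seq (popBit .main) <| .seq
    (.ite isTrue
      (.seq (.pop (some .main) fun v _ => v)
        (.seq (.pop (some .main) fun v _ => v) (pushBit (.aux true) true)))
      (pushBit (.aux true) false)) (popBit .main)) (pourAux true)

theorem write_runs (l : List Bool) (v : Option Γ') :
    Cmd.Runs write v (stks (sexp l).code) (11 * l.length + 4) none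
      (regs [] [] (update (fun _ => []) false l) []) := by
  have key : ∀ (l acc : List Bool),
      Cmd.Runs (.loop isTrue <| .seq (popBit .main) <| .seq
        (.ite isTrue
          (.seq (.pop (some .main) fun v _ => v)
            (.seq (.pop (some .main) fun v _ => v) (pushBit (.aux true) true)))
          (pushBit (.aux true) false)) (popBit .main))
        ((sexp l).code.head?.map Γ'.bit)
        (regs [] (sexp l).code.tail (update (fun _ => []) true acc) [])
        (8 * l.length + 1) (some (.bit false))
        (regs [] [] (update (fun _ => []) true (l.reverse ++ acc)) []) := by
    intro l
    induction l with
    | nil => intro acc; exact Cmd.Runs.loop_done rfl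
    | cons b l ih =>
      intro acc
      cases b with
      | true =>
        refine Cmd.Runs.mono (T := (1 + ((1 + (1 + 1) + 1) + 1)) + (8 * l.length + 1) + 1)
          (Cmd.Runs.loop_step rfl (Cmd.Runs.seq
          (Cmd.Runs.pop (v' := some (Γ'.bit true)) (S' := regs [] (false :: false :: (sexp l).code)
            (update (fun _ => []) true acc) []) rfl (by simp [Sexp.code])) (Cmd.Runs.seq
              (.ite_true rfl (.seq (.pop (S' := regs [] (false :: (sexp l).code)
                (update (fun _ => []) true acc) []) rfl (by simp))
                (.seq (.pop (S' := regs [] (sexp l).code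
                (update (fun _ => []) true acc) []) rfl (by simp)) (.push rfl)))) (.pop rfl rfl)))
                ?_) (by simp; omega)
        simpa using ih (true :: acc)
      | false =>
        refine Cmd.Runs.mono (T := (1 + ((1 + 1) + 1)) + (8 * l.length + 1) + 1)
          (Cmd.Runs.loop_step rfl (Cmd.Runs.seq
          (Cmd.Runs.pop (v' := some (Γ'.bit false)) (S' := regs [] (sexp l).code
            (update (fun _ => []) true acc) []) rfl (by simp [Sexp.code])) (Cmd.Runs.seq
              (.ite_false rfl (.push rfl)) (.pop rfl rfl)))
                ?_) (by simp; omega)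
        simpa using ih (false :: acc)
  have e1 : update (fun _ => []) true [] = (fun _ => ([] : List Bool)) := by
    funext d; cases d <;> simp
  have e2 : update (update (update (fun _ => []) true l.reverse) false l) true [] =
      update (fun _ => ([] : List Bool)) false l := by
    funext d; cases d <;> simp
  have h1 := key l []
  have h2 := pourAux_runs true [] [] (update (fun _ => []) true l.reverse) [] (some (.bit false))
  simp only [e1, e2, List.append_nil, update_self, List.reverse_reverse, Bool.not_true, ne_eq,
    Bool.false_eq_true, not_false_eq_true, update_of_ne, List.length_reverse] at h1 h2
  refine ((Cmd.Runs.pop rfl rfl).seq (Cmd.Runs.seq ?_ h2)).mono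
    (show 1 + (8 * l.length + 1 + (3 * l.length + 2)) ≤ _ by omega)
  simpa [stks] using h1

end RegCmd

/-- A polynomial-time function of the word of an instance is in FP. -/
theorem PolyTime.inFP {ι : Type} {enc : ι → List Γ'} {f : ι → ℕ}
    (h : @PolyTime ι ℕ ⟨fun i => sexp (enc i)⟩ _ f) : InFP enc f := by
  let _ : SexpRep ι := ⟨fun i => sexp (enc i)⟩
  obtain ⟨c, T, ⟨p, hp⟩, ⟨q, hq⟩, hr⟩ := h
  have hrun : ∀ i, Cmd.Runs (.seq RegCmd.read (.seq c RegCmd.write)) none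
      (regs (enc i) [] (fun _ => []) [])
      ((18 * (enc i).length + 3 * sz (enc i) + 5) + (T i + (11 * (encodeNat (f i)).length + 4)))
      none (regs [] [] (update (fun _ => []) false (encodeNat (f i))) []) := by
    intro i
    refine (RegCmd.read_runs (enc i) none).seq (Cmd.Runs.seq ?_ (RegCmd.write_runs _ none))
    have := hr i none []
    rwa [List.append_nil, List.append_nil] at this
  -- A symbol has size at most `7` and its `cons` adds `1`; the final `nil` is the remaining `1`.
  -- This turns bounds in the size of the tree into bounds in the length of the word.
  let s : Polynomial ℕ := 8 * .X + 1
  have hs : ∀ i, sz i ≤ s.eval (enc i).length := by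
    intro i
    have h1 := sz_le_of_forall (l := enc i) (n := 7) fun t _ => sz_symbol_le t
    simp only [s, Polynomial.eval_add, Polynomial.eval_mul, Polynomial.eval_ofNat,
      Polynomial.eval_X, Polynomial.eval_one]
    change sz (enc i) ≤ _
    omega
  refine ⟨{ tm := Cmd.toFinTM2 (.seq RegCmd.read (.seq c RegCmd.write)) none (some (.aux false))
              none
            inputAlphabet := Equiv.refl Γ'
            outputAlphabet := Equiv.refl Bool
            time := 18 * .X + 3 * s + 5 + (p.comp s + (11 * q.comp s + 4)) + 1
            outputsFun := fun i => ?_ }⟩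
  have hi := hrun i
  refine ⟨⟨hi.choose + 1, ?_⟩, ?_⟩
  · have h1 := hi.choose_spec.2.toFinTM2 (k₀ := none) (k₁ := some (.aux false))
    convert h1 using 2
    · refine congrArg some ?_
      unfold initList
      refine congrArg₂ (fun v S => (⟨_, v, S⟩ : TM2.Cfg _ _ _)) rfl ?_
      funext k
      rcases k with _ | _ | d | _
      · exact List.map_id _
      all_goals rfl
    · refine congrArg some ?_
      unfold haltList
      refine congrArg₂ (fun v S => (⟨_, v, S⟩ : TM2.Cfg _ _ _)) rfl ?_
      funext k
      rcases k with _ | _ | (_ | _) | _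
      · rfl
      · rfl
      · exact List.map_id _
      all_goals rfl
  · refine Nat.succ_le_succ hi.choose_spec.1 |>.trans ?_
    have h1 : T i ≤ p.eval (s.eval (enc i).length) := (hp i).trans (p.eval_mono_nat (hs i))
    have h2 : sz (f i) ≤ q.eval (s.eval (enc i).length) := (hq i).trans (q.eval_mono_nat (hs i))
    have h3 : (encodeNat (f i)).length < sz (f i) := length_lt_sz (encodeNat (f i))
    have h4 : sz (enc i) ≤ s.eval (enc i).length := hs i
    simp only [Polynomial.eval_add, Polynomial.eval_mul, Polynomial.eval_ofNat, Polynomial.eval_X,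
      Polynomial.eval_one, Polynomial.eval_comp]
    omega

/-! #### Parsing -/

/-- One step of a parser, whose state holds the bits of the number that is being read and, for
each open bracket, the reversed list of the entries read so far. -/
def parseStep (s : List Bool × List (List Sexp)) (t : Γ') : List Bool × List (List Sexp) :=
  bif t == Γ'.bra then (s.1, [] :: s.2)
  else bif t == Γ'.ket then
    (s.1, (sexp (s.2.headD []).reverse :: s.2.tail.headD []) :: s.2.tail.tail)
  else bif t == Γ'.comma then ([], (sexp s.1.reverse :: s.2.headD []) :: s.2.tail)
  else bif t == Γ'.bit true then (true :: s.1, s.2)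
  else bif t == Γ'.bit false then (false :: s.1, s.2)
  else s

/-- The initial stack has a single level, outside all brackets, which collects the top-level entries
in reverse order. -/
def parse (w : List Γ') : List Sexp := (w.foldl parseStep ([], [[]])).2.headD []

theorem PolyTime.parse : PolyTime parse := by
  have hh : PolyTime fun q : List Γ' × (List Bool × List (List Sexp)) × Γ' =>
      q.2.1.2.headD [] := headD (by fun_prop) _ rfl
  have hh' : PolyTime fun q : List Γ' × (List Bool × List (List Sexp)) × Γ' =>
      q.2.1.2.tail.headD [] := headD (by fun_prop) _ rfl
  refine headD (snd.comp (foldl_of_growth (l := fun w : List Γ' => w)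
    (i := fun _ => (([], [[]]) : List Bool × List (List Sexp))) (s := fun _ s t => parseStep s t)
    (fun _ _ => 10) id' (const _) ?_ (.const 10) ?_)) _ rfl
  · unfold parseStep
    fun_prop
  · intro a s t _
    obtain ⟨b, l⟩ := s
    unfold parseStep
    simp only [sz_mk]
    cases t == Γ'.bra with
    | true => simp; omega
    | false =>
    cases t == Γ'.ket with
    | true =>
      have hz : ∀ l : List Sexp, sz (sexp l) = sz l := fun _ => rfl
      have h1 : sz Sexp.nil = 1 := rfl
      rcases l with _ | ⟨l, _ | ⟨l', l''⟩⟩ <;> simp [hz, h1] <;> omega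
    | false =>
    cases t == Γ'.comma with
    | true =>
      have hz : sz (sexp b.reverse) = sz b := sz_reverse b
      cases l <;> simp [hz] <;> omega
    | false =>
    cases t == Γ'.bit true with
    | true => have := sz_bool_le true; simp; omega
    | false =>
    cases t == Γ'.bit false with
    | true => have := sz_bool_le false; simp; omega
    | false => simp

/-- `w` is read as an entry `x`. -/
def ParsesAs (w : List Γ') (x : Sexp) : Prop :=
  ∀ l ls, w.foldl parseStep ([], l :: ls) = ([], (x :: l) :: ls)

theorem parsesAs_natWord (n : ℕ) : ParsesAs (natWord n) (sexp n) := by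
  intro l ls
  have key : ∀ (w b : List Bool), (w.map Γ'.bit).foldl parseStep (b, l :: ls) =
      (w.reverse ++ b, l :: ls) := by
    intro w
    induction w with
    | nil => simp
    | cons c w ih =>
      intro b
      have h0 : parseStep (b, l :: ls) (Γ'.bit c) = (c :: b, l :: ls) := by cases c <;> rfl
      simpa [h0] using ih (c :: b)
  have h1 : ∀ b, parseStep (b, l :: ls) Γ'.comma = ([], (sexp b.reverse :: l) :: ls) :=
    fun _ => rfl
  rw [natWord, List.foldl_append, key]
  simp [h1, sexp_nat]

theorem parsesAs_listWord {β : Type} [SexpRep β] {enc : β → List Γ'}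
    (h : ∀ b, ParsesAs (enc b) (sexp b)) (l : List β) : ParsesAs (listWord enc l) (sexp l) := by
  intro m ls
  have key : ∀ (l : List β) (n : List Sexp) (ls : List (List Sexp)),
      (l.flatMap enc).foldl parseStep ([], n :: ls) = ([], ((l.map sexp).reverse ++ n) :: ls) := by
    intro l
    induction l with
    | nil => simp
    | cons b l ih => intro n ls; simp [List.foldl_append, h b n ls, ih]
  have hl : sexp (l.map sexp) = sexp l := by
    induction l with
    | nil => rfl
    | cons b l ih => simp [ih]
  rw [listWord, List.foldl_cons, List.foldl_append]
  have h0 : parseStep ([], m :: ls) Γ'.bra = ([], [] :: m :: ls) := rfl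
  have h1 : ∀ n, parseStep ([], n :: m :: ls) Γ'.ket = ([], (sexp n.reverse :: m) :: ls) :=
    fun _ => rfl
  rw [h0, key]
  simp [h1, hl]

/-- An instance is represented by its input word, so that polynomial time is measured in the word
and `PolyTime.inFP` applies; the fields have to be obtained by parsing. -/
instance : SexpRep (ACInstance ℕ) := ⟨fun I => sexp I.word⟩
instance : SexpRep (DCInstance ℕ) := ⟨fun I => sexp I.word⟩

theorem ACInstance.parse_word (I : ACInstance ℕ) : parse I.word =
    [sexp I.bound, sexp I.p, sexp I.V, sexp I.axis, sexp I.A, sexp I.C] := by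
  have hl := fun l => parsesAs_listWord parsesAs_natWord l
  simp only [parse, ACInstance.word, List.foldl_append]
  rw [hl, hl, hl, parsesAs_listWord hl, parsesAs_natWord, parsesAs_natWord]
  rfl

theorem DCInstance.parse_word (I : DCInstance ℕ) : parse I.word =
    [sexp I.bound, sexp I.p, sexp I.V, sexp I.axis, sexp I.C] := by
  have hl := fun l => parsesAs_listWord parsesAs_natWord l
  simp only [parse, DCInstance.word, List.foldl_append]
  rw [hl, hl, parsesAs_listWord hl, parsesAs_natWord, parsesAs_natWord]
  rfl

namespace PolyTime

/-- The parser already produces the tree that represents the field, so its extraction needs no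
conversion. -/
theorem nth_entry {ι β : Type} [SexpRep ι] [SexpRep β] {L : ι → List Sexp} (hL : PolyTime L)
    (n : ℕ) {f : ι → β} (h : ∀ i, (L i)[n]? = some (sexp (f i))) : PolyTime f :=
  (headD (drop hL n) Sexp.nil rfl).congr_sexp fun i => by
    rw [List.headD_eq_head?_getD, List.head?_drop, h]
    rfl

theorem parse_AC : PolyTime fun I : ACInstance ℕ => _root_.parse I.word :=
  parse.comp (of_sexp_eq fun _ => rfl)

theorem parse_DC : PolyTime fun I : DCInstance ℕ => _root_.parse I.word :=
  parse.comp (of_sexp_eq fun _ => rfl)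

theorem AC_bound : PolyTime (ACInstance.bound : ACInstance ℕ → ℕ) :=
  nth_entry parse_AC 0 fun I => by simp [I.parse_word]
theorem AC_p : PolyTime (ACInstance.p : ACInstance ℕ → ℕ) :=
  nth_entry parse_AC 1 fun I => by simp [I.parse_word]
theorem AC_V : PolyTime (ACInstance.V : ACInstance ℕ → List (List ℕ)) :=
  nth_entry parse_AC 2 fun I => by simp [I.parse_word]
theorem AC_axis : PolyTime (ACInstance.axis : ACInstance ℕ → List ℕ) :=
  nth_entry parse_AC 3 fun I => by simp [I.parse_word]
theorem AC_A : PolyTime (ACInstance.A : ACInstance ℕ → List ℕ) :=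
  nth_entry parse_AC 4 fun I => by simp [I.parse_word]

theorem DC_bound : PolyTime (DCInstance.bound : DCInstance ℕ → ℕ) :=
  nth_entry parse_DC 0 fun I => by simp [I.parse_word]
theorem DC_p : PolyTime (DCInstance.p : DCInstance ℕ → ℕ) :=
  nth_entry parse_DC 1 fun I => by simp [I.parse_word]
theorem DC_V : PolyTime (DCInstance.V : DCInstance ℕ → List (List ℕ)) :=
  nth_entry parse_DC 2 fun I => by simp [I.parse_word]
theorem DC_axis : PolyTime (DCInstance.axis : DCInstance ℕ → List ℕ) :=
  nth_entry parse_DC 3 fun I => by simp [I.parse_word]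

end PolyTime

end InputOutput

/-! ### The algorithm -/

section Algorithm

open SexpRep

/-- Does the vote `v` place `a` before `b`? -/
def prefers (v : List ℕ) (a b : ℕ) : Bool :=
  (v.filter fun x => x == a || x == b).head? == some a

/-- The votes that prefer `o`, if there is such a candidate, to `c`. -/
def beating (V : List (List ℕ)) (o : Option ℕ) (c : ℕ) : List (List ℕ) :=
  o.toList.flatMap fun a => V.filter fun v => prefers v a c

/-- The votes that do not approve of `c`, if `l` and `r` are the `k`-th neighbours of `c`. -/
def losing (V : List (List ℕ)) (l r : Option ℕ) (c : ℕ) : List (List ℕ) :=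
  beating V l c ++ beating V r c

/-- If `c` is the designated candidate, then its `k`-th neighbours are as guessed. -/
def guessOk (p : ℕ) (l₀ r₀ l c r : Option ℕ) : Bool :=
  !(c == some p) || (l == l₀ && r == r₀)

/-- The candidate `c`, with `k`-th neighbours `l` and `r`, prevents `p` from winning alone. -/
def beats (V : List (List ℕ)) (p : ℕ) (l₀ r₀ l c r : Option ℕ) : Bool :=
  c.toList.any fun x =>
    -- The result is empty when `x` is disapproved of by at most as many voters as `p`, that is,
    -- when its score is at least that of `p`. Ties count, as `p` must win alone.
    !(x == p) && ((losing V l r x).drop (losing V l₀ r₀ p).length).isEmpty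

/-- The states of the automaton that reads the participating candidates along the axis: the last
`2 * k` of them, the number of candidates added or deleted so far, and whether the guess was right
and the designated candidate was beaten so far. -/
abbrev ScanState : Type := List (Option ℕ) × ℕ × Bool × Bool

/-- An entry of the axis, the cost of its participation, and the cost of its
absence (if it may be absent). -/
abbrev ScanItem : Type := Option ℕ × ℕ × Option ℕ

def nthOr (l : List (Option ℕ)) (n : ℕ) : Option ℕ := (l.drop n).headD none

/-- The window lists the latest participant first. When `y` is read, the candidate at index `k` of
`y :: q.1` has both its `k`-th neighbours in sight: the left one at index `2 * k`, and `y` on the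
right. It is judged at this moment. -/
def scanTake (k : ℕ) (V : List (List ℕ)) (p : ℕ) (l₀ r₀ : Option ℕ) (y : Option ℕ) (t : ℕ)
    (q : ScanState) : ScanState :=
  ((y :: q.1).take (2 * k), q.2.1 + t,
    q.2.2.1 && guessOk p l₀ r₀ (nthOr (y :: q.1) (2 * k)) (nthOr (y :: q.1) k) y,
    q.2.2.2 || beats V p l₀ r₀ (nthOr (y :: q.1) (2 * k)) (nthOr (y :: q.1) k) y)

def scanMoves (k : ℕ) (V : List (List ℕ)) (p : ℕ) (l₀ r₀ : Option ℕ) (x : ScanItem)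
    (q : ScanState) : List ScanState :=
  scanTake k V p l₀ r₀ x.1 x.2.1 q :: x.2.2.toList.map fun s => (q.1, q.2.1 + s, q.2.2)

def listsOfLength {α : Type} (o : List α) : ℕ → List (List α)
  | 0 => [[]]
  | n + 1 => (listsOfLength o n).flatMap fun w => o.map fun x => x :: w

/-- For fixed `k` the number of states is polynomial: the windows number `o.length ^ (2 * k)`, with
`J.length` costs and four pairs of flags. -/
def scanStates (k : ℕ) (o : List (Option ℕ)) (J : List ℕ) : List ScanState :=
  (listsOfLength o (2 * k)).flatMap fun W => J.flatMap fun j =>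
    [true, false].flatMap fun a => [true, false].map fun b => (W, j, a, b)

/-- The default `0` matters: a state outside the table, such as one over budget, has no accepting
runs. -/
def lookupOr {α : Type} [DecidableEq α] (T : List (α × ℕ)) (q : α) : ℕ :=
  ((T.filter fun e => e.1 == q).map Prod.snd).headD 0

/-- Dynamic programming from the end of the axis: for each state, the table holds the number of
accepting runs over the items already treated, a suffix of the sequence. -/
def scanTable (k : ℕ) (V : List (List ℕ)) (p : ℕ) (l₀ r₀ : Option ℕ) (want : Bool)
    (Q : List ScanState) (items : List ScanItem) : List (ScanState × ℕ) :=
  items.reverse.foldl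
    (fun T x => Q.map fun q => (q, ((scanMoves k V p l₀ r₀ x q).map fun q' => lookupOr T q').sum))
    (Q.map fun q => (q, bif q.2.2.1 && q.2.2.2 == want then 1 else 0))

/-- The numbers up to the minimum of `bound` and the length of a list. -/
def budgets (bound : ℕ) (l : List ℕ) : List ℕ :=
  (l.foldl (fun (s : ℕ × List ℕ) _ => bif s.1 == bound then s else (s.1 + 1, (s.1 + 1) :: s.2))
    (0, [0])).2

/-- The entries of the axis, followed by `k` dummies. For `mode = true`, the candidates in `O` may
be added, for `mode = false` they may be deleted. -/
def scanItems (k : ℕ) (mode : Bool) (O axis : List ℕ) : List ScanItem :=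
  axis.map (fun x => bif O.any (fun y => y == x) then
      bif mode then (some x, 1, some 0) else (some x, 0, some 1)
    else (some x, 0, none)) ++ List.replicate k (none, 0, none)

/-- The sum ranges over all guesses of the `k`-th neighbours of `p`, where `none` stands for a
missing one. The scan starts with a window of dummies, cost `0`, no wrong guess found and `p` not
beaten. -/
def solve (k : ℕ) (mode want : Bool) (axis O : List ℕ) (V : List (List ℕ)) (p bound : ℕ) : ℕ :=
  let o := none :: axis.map some
  let Q := scanStates k o (budgets bound axis)
  let items := scanItems k mode O axis
  (o.flatMap fun l₀ => o.map fun r₀ =>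
    lookupOr (scanTable k V p l₀ r₀ want Q items)
      (List.replicate (2 * k) none, 0, true, false)).sum

/-! ### The algorithm runs in polynomial time -/

namespace PolyTime

variable {α β γ : Type} [SexpRep α] [SexpRep β] [SexpRep γ]

@[fun_prop]
theorem prefers {v : α → List ℕ} {a b : α → ℕ} (hv : PolyTime v) (ha : PolyTime a)
    (hb : PolyTime b) : PolyTime fun x => prefers (v x) (a x) (b x) := by
  unfold _root_.prefers
  fun_prop

@[fun_prop]
theorem beating {V : α → List (List ℕ)} {o : α → Option ℕ} {c : α → ℕ} (hV : PolyTime V)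
    (ho : PolyTime o) (hc : PolyTime c) : PolyTime fun x => beating (V x) (o x) (c x) := by
  unfold _root_.beating
  fun_prop

@[fun_prop]
theorem losing {V : α → List (List ℕ)} {l r : α → Option ℕ} {c : α → ℕ} (hV : PolyTime V)
    (hl : PolyTime l) (hr : PolyTime r) (hc : PolyTime c) :
    PolyTime fun x => losing (V x) (l x) (r x) (c x) := by
  unfold _root_.losing
  fun_prop

@[fun_prop]
theorem guessOk {p : α → ℕ} {l₀ r₀ l c r : α → Option ℕ} (hp : PolyTime p) (hl₀ : PolyTime l₀)
    (hr₀ : PolyTime r₀) (hl : PolyTime l) (hc : PolyTime c) (hr : PolyTime r) :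
    PolyTime fun x => guessOk (p x) (l₀ x) (r₀ x) (l x) (c x) (r x) := by
  unfold _root_.guessOk
  fun_prop

@[fun_prop]
theorem beats {V : α → List (List ℕ)} {p : α → ℕ} {l₀ r₀ l c r : α → Option ℕ} (hV : PolyTime V)
    (hp : PolyTime p) (hl₀ : PolyTime l₀)
    (hr₀ : PolyTime r₀) (hl : PolyTime l) (hc : PolyTime c) (hr : PolyTime r) :
    PolyTime fun x => beats (V x) (p x) (l₀ x) (r₀ x) (l x) (c x) (r x) := by
  unfold _root_.beats
  fun_prop

theorem nthOr {l : α → List (Option ℕ)} (hl : PolyTime l) (n : ℕ) :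
    PolyTime fun x => nthOr (l x) n :=
  headD (drop hl n) _ rfl

@[fun_prop]
theorem scanTake (k : ℕ) {V : α → List (List ℕ)} {p : α → ℕ} {l₀ r₀ : α → Option ℕ}
    {y : α → Option ℕ} {t : α → ℕ} {q : α → ScanState} (hV : PolyTime V) (hp : PolyTime p)
    (hl₀ : PolyTime l₀) (hr₀ : PolyTime r₀) (hy : PolyTime y) (ht : PolyTime t)
    (hq : PolyTime q) :
    PolyTime fun x => scanTake k (V x) (p x) (l₀ x) (r₀ x) (y x) (t x) (q x) := by
  have hW : PolyTime fun x => y x :: (q x).1 := by fun_prop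
  have h1 := nthOr hW (2 * k)
  have h2 := nthOr hW k
  have h3 := take hW (2 * k)
  exact pair h3 (pair (by fun_prop) (pair (and (by fun_prop) (guessOk hp hl₀ hr₀ h1 h2 hy))
    (or (by fun_prop) (beats hV hp hl₀ hr₀ h1 h2 hy))))

@[fun_prop]
theorem scanMoves (k : ℕ) {V : α → List (List ℕ)} {p : α → ℕ} {l₀ r₀ : α → Option ℕ}
    {i : α → ScanItem} {q : α → ScanState} (hV : PolyTime V) (hp : PolyTime p)
    (hl₀ : PolyTime l₀) (hr₀ : PolyTime r₀) (hi : PolyTime i) (hq : PolyTime q) :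
    PolyTime fun x => scanMoves k (V x) (p x) (l₀ x) (r₀ x) (i x) (q x) := by
  unfold _root_.scanMoves
  fun_prop

theorem listsOfLength {o : α → List β} (ho : PolyTime o) (n : ℕ) :
    PolyTime fun x => listsOfLength (o x) n := by
  induction n with
  | zero => exact const [[]]
  | succ n ih =>
    unfold _root_.listsOfLength
    fun_prop

@[fun_prop]
theorem scanStates (k : ℕ) {o : α → List (Option ℕ)} {J : α → List ℕ} (ho : PolyTime o)
    (hJ : PolyTime J) : PolyTime fun x => scanStates k (o x) (J x) := by
  have := listsOfLength ho (2 * k)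
  unfold _root_.scanStates
  fun_prop

@[fun_prop]
theorem lookupOr [SexpInj β] [DecidableEq β] {T : α → List (β × ℕ)} {q : α → β} (hT : PolyTime T)
    (hq : PolyTime q) : PolyTime fun x => lookupOr (T x) (q x) :=
  headD (by fun_prop) _ rfl

end PolyTime

theorem lookupOr_map {α : Type} [DecidableEq α] (Q : List α) (g : α → ℕ) (q : α) :
    lookupOr (Q.map fun q => (q, g q)) q = if q ∈ Q then g q else 0 := by
  induction Q with
  | nil => rfl
  | cons r Q ih =>
    by_cases h : r = q
    · subst h; simp [lookupOr]
    · have : lookupOr ((r :: Q).map fun q => (q, g q)) q = lookupOr (Q.map fun q => (q, g q)) q := by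
        simp [lookupOr, h]
      rw [this, ih]
      simp [Ne.symm h]

theorem sum_scanMoves_le (k : ℕ) (V : List (List ℕ)) (p : ℕ) (l₀ r₀ : Option ℕ) (x : ScanItem)
    (q : ScanState) (f : ScanState → ℕ) (n : ℕ) (h : ∀ q, f q ≤ n) :
    ((scanMoves k V p l₀ r₀ x q).map f).sum ≤ 2 * n := by
  obtain ⟨y, t, s⟩ := x
  cases s with
  | none =>
    have := h (scanTake k V p l₀ r₀ y t q)
    simp [scanMoves]; omega
  | some s =>
    have := h (scanTake k V p l₀ r₀ y t q)
    have := h (q.1, q.2.1 + s, q.2.2)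
    simp [scanMoves]; omega

/-- At most two moves leave each state, so an item at most doubles the largest entry. Numbers up to
`2 ^ l.length` have linearly many bits, although they count exponentially many sets. -/
theorem scanTable_fold (k : ℕ) (V : List (List ℕ)) (p : ℕ) (l₀ r₀ : Option ℕ)
    (Q : List ScanState) (l : List ScanItem) (g : ScanState → ℕ) (n : ℕ) (hg : ∀ q, g q ≤ n) :
    ∃ g' : ScanState → ℕ, (∀ q, g' q ≤ 2 ^ l.length * n) ∧
      l.foldl (fun T x => Q.map fun q =>
        (q, ((scanMoves k V p l₀ r₀ x q).map fun q' => lookupOr T q').sum))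
        (Q.map fun q => (q, g q)) = Q.map fun q => (q, g' q) := by
  induction l generalizing g n with
  | nil => exact ⟨g, by simpa using hg, rfl⟩
  | cons x l ih =>
    obtain ⟨g', h1, h2⟩ := ih (fun q => ((scanMoves k V p l₀ r₀ x q).map fun q' =>
      lookupOr (Q.map fun q => (q, g q)) q').sum) (2 * n) (fun q =>
        sum_scanMoves_le k V p l₀ r₀ x q _ n fun q => by
          rw [lookupOr_map]
          split_ifs
          · exact hg q
          · exact Nat.zero_le _)
    exact ⟨g', fun q => (h1 q).trans_eq (by rw [List.length_cons, pow_succ]; ring), h2⟩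

namespace PolyTime

variable {α : Type} [SexpRep α]

@[fun_prop]
theorem scanTable (k : ℕ) (want : Bool) {V : α → List (List ℕ)} {p : α → ℕ} {l₀ r₀ : α → Option ℕ}
    {Q : α → List ScanState} {i : α → List ScanItem} (hV : PolyTime V) (hp : PolyTime p)
    (hl₀ : PolyTime l₀) (hr₀ : PolyTime r₀) (hQ : PolyTime Q) (hi : PolyTime i) :
    PolyTime fun x => scanTable k (V x) (p x) (l₀ x) (r₀ x) want (Q x) (i x) := by
  unfold _root_.scanTable
  have hs : PolyTime fun q : α × List (ScanState × ℕ) × ScanItem => (Q q.1).map fun q' =>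
      (q', ((_root_.scanMoves k (V q.1) (p q.1) (l₀ q.1) (r₀ q.1) q.2.2 q').map
        fun q'' => _root_.lookupOr q.2.1 q'').sum) := by
    fun_prop
  -- The bound `b` allows, for each state, the state itself and a number whose bit length is at most
  -- the size of the list of items.
  refine foldl (l := fun x => (i x).reverse) (s := fun x T y => (Q x).map fun q =>
      (q, ((_root_.scanMoves k (V x) (p x) (l₀ x) (r₀ x) y q).map
        fun q' => _root_.lookupOr T q').sum))
    (i := fun x => (Q x).map fun q => (q, bif q.2.2.1 && q.2.2.2 == want then 1 else 0))
    (b := fun x => sz (Q x) * (sz (Q x) + (4 * sz (i x) + 1) + 1 + 1) + 1)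
    (by fun_prop) (by fun_prop) hs ?_ ?_
  · exact (hQ.sz_bdd.mul (((hQ.sz_bdd.add (((PolyBdd.const 4).mul hi.sz_bdd).add (.const 1))).add
      (.const 1)).add (.const 1))).add (.const 1)
  · intro x l' hl'
    obtain ⟨g, h1, h2⟩ := scanTable_fold k (V x) (p x) (l₀ x) (r₀ x) (Q x) l'
      (fun q => bif q.2.2.1 && q.2.2.2 == want then 1 else 0) 1 (fun q => by
        cases q.2.2.1 && q.2.2.2 == want <;> simp)
    rw [h2]
    refine (sz_le_of_forall (n := sz (Q x) + (4 * sz (i x) + 1) + 1) ?_).trans ?_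
    · intro e he
      obtain ⟨q, hq, rfl⟩ := List.mem_map.1 he
      have e1 := sz_le_of_mem hq
      have e2 := sz_nat_le (g q)
      have e3 : (g q).size ≤ sz (i x) := by
        refine (Nat.size_le.2 ((h1 q).trans_lt ?_))
        have e4 := hl'.length_le
        have e5 := length_lt_sz (i x)
        rw [List.length_reverse] at e4
        rw [mul_one]
        exact Nat.pow_lt_pow_right (by omega) (by omega)
      simp only [sz_mk]
      omega
    · rw [List.length_map]
      gcongr
      exact (length_lt_sz _).le

end PolyTime

theorem budgets_fold (bound : ℕ) (l : List ℕ) (j : ℕ) (hj : j ≤ bound) :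
    l.foldl (fun (s : ℕ × List ℕ) _ => bif s.1 == bound then s else (s.1 + 1, (s.1 + 1) :: s.2))
      (j, (List.range (j + 1)).reverse) =
    (min bound (j + l.length), (List.range (min bound (j + l.length) + 1)).reverse) := by
  induction l generalizing j with
  | nil => simp [hj]
  | cons x l ih =>
    rw [List.foldl_cons]
    by_cases h : j = bound
    · subst h
      have := ih j le_rfl
      simp only [beq_self_eq_true, cond_true] at this ⊢
      rw [this]
      simp
    · have h0 : (j == bound) = false := by simpa using h
      have := ih (j + 1) (by omega)
      rw [List.range_succ, List.reverse_append] at this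
      simp only [h0, cond_false]
      simp only [List.reverse_singleton, List.singleton_append] at this
      rw [this, List.length_cons, show j + 1 + l.length = j + (l.length + 1) by omega]

namespace PolyTime

variable {α : Type} [SexpRep α]

theorem sz_nat_le_self (n : ℕ) : sz n ≤ 4 * n + 1 := by
  have h1 := sz_nat_le n
  have h2 : n.size ≤ n := Nat.size_le.2 Nat.lt_two_pow_self
  omega

-- The bound is given in binary and may be exponential in the length of the input. Running over the
-- axis caps the budgets, without loss since no more candidates than those on the axis can be added
-- or deleted.
@[fun_prop]
theorem budgets {b : α → ℕ} {l : α → List ℕ} (hb : PolyTime b) (hl : PolyTime l) :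
    PolyTime fun x => budgets (b x) (l x) := by
  refine snd.comp (foldl (l := l) (i := fun _ => ((0, [0]) : ℕ × List ℕ))
    (s := fun x s _ => bif s.1 == b x then s else (s.1 + 1, (s.1 + 1) :: s.2))
    (b := fun x => (4 * sz (l x) + 1) +
      (sz (l x) * (4 * sz (l x) + 1 + 1) + 1) + 1) hl (const _) (by fun_prop) ?_ ?_)
  · have h4 := (PolyBdd.const (α := α) 4).mul hl.sz_bdd
    exact ((h4.add (.const 1)).add ((hl.sz_bdd.mul ((h4.add (.const 1)).add (.const 1))).add
      (.const 1))).add (.const 1)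
  · intro x l' hl'
    have := budgets_fold (b x) l' 0 (Nat.zero_le _)
    simp only [zero_add, List.range_one, List.reverse_singleton] at this
    rw [this, sz_mk, sz_reverse]
    have e1 := hl'.length_le
    have e2 := length_lt_sz (l x)
    have e3 : min (b x) l'.length ≤ l'.length := min_le_right _ _
    have e4 := sz_nat_le_self (min (b x) l'.length)
    have e5 := sz_le_of_forall (l := List.range (min (b x) l'.length + 1))
      (n := 4 * sz (l x) + 1) fun j hj => by
        have := sz_nat_le_self j
        rw [List.mem_range] at hj
        omega
    rw [List.length_range] at e5
    have e6 : (min (b x) l'.length + 1) * (4 * sz (l x) + 1 + 1) ≤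
        sz (l x) * (4 * sz (l x) + 1 + 1) := Nat.mul_le_mul_right _ (by omega)
    omega

@[fun_prop]
theorem scanItems (k : ℕ) (mode : Bool) {O l : α → List ℕ} (hO : PolyTime O) (hl : PolyTime l) :
    PolyTime fun x => scanItems k mode (O x) (l x) := by
  unfold _root_.scanItems
  fun_prop

theorem solve (k : ℕ) (mode want : Bool) {axis O : α → List ℕ} {V : α → List (List ℕ)}
    {p bound : α → ℕ} (ha : PolyTime axis) (hO : PolyTime O) (hV : PolyTime V) (hp : PolyTime p)
    (hb : PolyTime bound) :
    PolyTime fun x => solve k mode want (axis x) (O x) (V x) (p x) (bound x) := by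
  unfold _root_.solve
  fun_prop

end PolyTime

end Algorithm

/-! ### Scores in single-peaked elections -/

section SinglePeakedScores

/-- In a single-peaked sequence of distinct ranks, fewer than `k` ranks are better than the `r`-th
one if and only if neither of the two ranks at distance `k` is. -/
theorem card_better_lt_iff {n k r : ℕ} (f : ℕ → ℕ) (hk : 1 ≤ k) (hr : r < n)
    (hinj : ∀ i < n, ∀ j < n, f i = f j → i = j)
    (hl : ∀ i j m, i < j → j < m → m < n → f i < f j → f j < f m)
    (hr' : ∀ i j m, i < j → j < m → m < n → f m < f j → f j < f i) :
    ((Finset.range n).filter fun i => f i < f r).card < k ↔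
      ¬ (k ≤ r ∧ f (r - k) < f r) ∧ ¬ (r + k < n ∧ f (r + k) < f r) := by
  constructor
  · intro h
    refine ⟨fun ⟨h1, h2⟩ => ?_, fun ⟨h1, h2⟩ => ?_⟩
    -- If the rank at distance `k` on the left is better, single-peakedness makes all those between
    -- it and `r` better, which is `k` ranks.
    · refine absurd (Finset.card_le_card (s := Finset.Ico (r - k) r)
        (t := (Finset.range n).filter fun i => f i < f r) fun i hi => ?_)
        (by rw [Nat.card_Ico]; omega)
      rw [Finset.mem_Ico] at hi
      rw [Finset.mem_filter, Finset.mem_range]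
      refine ⟨by omega, ?_⟩
      rcases Nat.eq_or_lt_of_le hi.1 with h3 | h3
      · rwa [← h3]
      · by_contra h4
        rcases Nat.lt_or_eq_of_le (not_lt.1 h4) with h5 | h5
        · have := hr' _ _ _ h3 hi.2 hr h5
          omega
        · have := hinj _ hr _ (by omega) h5
          omega
    · refine absurd (Finset.card_le_card (s := Finset.Ioc r (r + k))
        (t := (Finset.range n).filter fun i => f i < f r) fun i hi => ?_)
        (by rw [Nat.card_Ioc]; omega)
      rw [Finset.mem_Ioc] at hi
      rw [Finset.mem_filter, Finset.mem_range]
      refine ⟨by omega, ?_⟩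
      rcases Nat.eq_or_lt_of_le hi.2 with h3 | h3
      · rwa [h3]
      · by_contra h4
        rcases Nat.lt_or_eq_of_le (not_lt.1 h4) with h5 | h5
        · have := hl _ _ _ hi.1 h3 h1 h5
          omega
        · have := hinj _ hr _ (by omega) h5
          omega
  · rintro ⟨h1, h2⟩
    -- All better ranks lie on one side of `r`. If one is on the left, then none is on the right,
    -- and none is at distance `k` or more, since the rank at distance `k` would then be better too.
    by_cases h : ∃ i < r, f i < f r
    · obtain ⟨i, hi, hfi⟩ := h
      refine (Finset.card_le_card (t := Finset.Ico (r + 1 - k) r) fun j hj => ?_).trans_lt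
        (by rw [Nat.card_Ico]; omega)
      rw [Finset.mem_filter, Finset.mem_range] at hj
      rw [Finset.mem_Ico]
      have hjr : j < r := by
        rcases lt_trichotomy j r with h3 | h3 | h3
        · exact h3
        · subst h3; omega
        · have := hl _ _ _ hi h3 hj.1 hfi; omega
      refine ⟨?_, hjr⟩
      by_contra h4
      have h5 : k ≤ r := by omega
      have h6 : ¬ f (r - k) < f r := fun h6 => h1 ⟨h5, h6⟩
      rcases Nat.eq_or_lt_of_le (show j ≤ r - k by omega) with h7 | h7
      · rw [h7] at hj; exact h6 hj.2
      · by_cases h8 : f j < f (r - k)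
        · have := hl _ _ _ h7 (by omega) hr h8
          omega
        · omega
    · refine (Finset.card_le_card (t := Finset.Ioo r (r + k)) fun j hj => ?_).trans_lt
        (by rw [Nat.card_Ioo]; omega)
      rw [Finset.mem_filter, Finset.mem_range] at hj
      rw [Finset.mem_Ioo]
      have hjr : r < j := by
        rcases lt_trichotomy j r with h3 | h3 | h3
        · exact absurd ⟨j, h3, hj.2⟩ h
        · subst h3; omega
        · exact h3
      refine ⟨hjr, ?_⟩
      by_contra h4
      have h6 : ¬ f (r + k) < f r := fun h6 => h2 ⟨by omega, h6⟩
      rcases Nat.eq_or_lt_of_le (show r + k ≤ j by omega) with h7 | h7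
      · rw [← h7] at hj; exact h6 hj.2
      · by_cases h8 : f j < f (r + k)
        · have := hr' _ _ _ (show r < r + k by omega) h7 hj.1 h8
          omega
        · omega

theorem idxOf_filter {α : Type} [DecidableEq α] (P : α → Bool) (v : List α) {c : α}
    (hc : P c = true) : (v.filter P).idxOf c = ((v.take (v.idxOf c)).filter P).length := by
  induction v with
  | nil => simp
  | cons x v ih =>
    by_cases hx : x = c
    · subst hx; simp [hc]
    · rw [List.idxOf_cons_ne _ hx, List.take_succ_cons]
      cases h : P x
      · simp [h, ih]
      · simp [h, List.idxOf_cons_ne _ hx, ih]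

theorem mem_take_idxOf {α : Type} [DecidableEq α] {v : List α} {c d : α} :
    d ∈ v.take (v.idxOf c) ↔ d ∈ v ∧ v.idxOf d < v.idxOf c := by
  constructor
  · intro h
    have hd := List.mem_of_mem_take h
    exact ⟨hd, (List.mem_take_iff_idxOf_lt hd).1 h⟩
  · rintro ⟨hd, h⟩
    exact (List.mem_take_iff_idxOf_lt hd).2 h

theorem prefers_iff {v : List ℕ} {a b : ℕ} (hab : a ≠ b) (ha : a ∈ v) :
    prefers v a b = true ↔ v.idxOf a < v.idxOf b := by
  induction v with
  | nil => simp at ha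
  | cons x v ih =>
    by_cases hxa : x = a
    · subst hxa
      simp [prefers, List.idxOf_cons_ne _ hab]
    · by_cases hxb : x = b
      · subst hxb
        simp [prefers, hxa]
      · have h1 : prefers (x :: v) a b = prefers v a b := by simp [prefers, hxa, hxb]
        rw [h1, ih (by simpa [Ne.symm hxa] using ha), List.idxOf_cons_ne _ hxa,
          List.idxOf_cons_ne _ hxb]
        omega

/-- The entry `k` places before the `r`-th one. -/
def leftNbr (k : ℕ) (t : List ℕ) (r : ℕ) : Option ℕ := if k ≤ r then t[r - k]? else none

/-- The entry `k` places after the `r`-th one. -/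
def rightNbr (k : ℕ) (t : List ℕ) (r : ℕ) : Option ℕ := t[r + k]?

/-- Approval means that fewer than `k` participants are ranked better, so `card_better_lt_iff`
applies to the ranks along the axis. The second part says that the two ways of not being approved
exclude each other, so that the voters concerned can be counted separately and added. -/
theorem vote_approves_iff {k : ℕ} (hk : 1 ≤ k) {axis v t : List ℕ} (haxis : axis.Nodup)
    (hv : v.Perm axis) (hsp : SinglePeaked axis v) (ht : t.Sublist axis) {r : ℕ}
    (hr : r < t.length) :
    (t[r] ∈ (v.filter fun c => c ∈ t.toFinset).take k ↔
      (leftNbr k t r).toList.any (fun a => prefers v a t[r]) = false ∧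
      (rightNbr k t r).toList.any (fun a => prefers v a t[r]) = false) ∧
    ¬ ((leftNbr k t r).toList.any (fun a => prefers v a t[r]) = true ∧
      (rightNbr k t r).toList.any (fun a => prefers v a t[r]) = true) := by
  have hvn : v.Nodup := hv.nodup_iff.2 haxis
  have htn : t.Nodup := ht.nodup haxis
  have hmem : ∀ c ∈ t, c ∈ v := fun c hc => hv.mem_iff.2 (ht.subset hc)
  -- The rank in the unrestricted vote of the `i`-th participant. The default `0` is never used, as
  -- indices stay below `t.length`.
  set f : ℕ → ℕ := fun i => v.idxOf (t.getD i 0) with hf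
  have hget : ∀ i (hi : i < t.length), t.getD i 0 = t[i] := fun i hi => by
    rw [List.getD_eq_getElem _ _ hi]
  have hinj : ∀ i < t.length, ∀ j < t.length, f i = f j → i = j := by
    intro i hi j hj h
    simp only [hf, hget i hi, hget j hj] at h
    have := (List.idxOf_inj (hmem _ (List.getElem_mem hi))).1 h
    exact (htn.getElem_inj_iff).1 this
  have hax : ∀ i j, i < j → (hj : j < t.length) →
      Precedes axis (t.getD i 0) (t.getD j 0) := by
    intro i j hij hj
    obtain ⟨g, hg⟩ := List.sublist_iff_exists_orderEmbedding_getElem?_eq.1 ht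
    have e : ∀ i (hi : i < t.length), axis.idxOf (t.getD i 0) = g i := by
      intro i hi
      have h1 := hg i
      rw [List.getElem?_eq_getElem hi] at h1
      obtain ⟨h2, h3⟩ := List.getElem?_eq_some_iff.1 h1.symm
      rw [hget i hi, ← h3, haxis.idxOf_getElem]
    rw [Precedes, e i (by omega), e j hj]
    exact g.lt_iff_lt.2 hij
  have hmax : ∀ i, i < t.length → t.getD i 0 ∈ axis := fun i hi => by
    rw [hget i hi]; exact ht.subset (List.getElem_mem hi)
  have hl : ∀ i j m, i < j → j < m → m < t.length → f i < f j → f j < f m :=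
    fun i j m hij hjm hm => hsp _ (hmax i (by omega)) _ (hmax j (by omega)) _ (hmax m hm)
      (.inl ⟨hax i j hij (by omega), hax j m hjm hm⟩)
  have hr' : ∀ i j m, i < j → j < m → m < t.length → f m < f j → f j < f i :=
    fun i j m hij hjm hm => hsp _ (hmax m hm) _ (hmax j (by omega)) _ (hmax i (by omega))
      (.inr ⟨hax i j hij (by omega), hax j m hjm hm⟩)
  have hL : (leftNbr k t r).toList.any (fun a => prefers v a t[r]) = true ↔
      k ≤ r ∧ f (r - k) < f r := by
    unfold leftNbr
    split_ifs with h
    · have h1 : r - k < t.length := by omega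
      have hne : t[r - k] ≠ t[r] := fun he => by
        have := (htn.getElem_inj_iff).1 he
        omega
      rw [List.getElem?_eq_getElem h1]
      simp only [Option.toList_some, List.any_cons, List.any_nil, Bool.or_false]
      rw [prefers_iff hne (hmem _ (List.getElem_mem h1))]
      simp only [hf, hget _ h1, hget _ hr, h, true_and]
    · simp [h]
  have hR : (rightNbr k t r).toList.any (fun a => prefers v a t[r]) = true ↔
      r + k < t.length ∧ f (r + k) < f r := by
    unfold rightNbr
    by_cases h1 : r + k < t.length
    · have hne : t[r + k] ≠ t[r] := fun he => by
        have := (htn.getElem_inj_iff).1 he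
        omega
      rw [List.getElem?_eq_getElem h1]
      simp only [Option.toList_some, List.any_cons, List.any_nil, Bool.or_false]
      rw [prefers_iff hne (hmem _ (List.getElem_mem h1))]
      simp only [hf, hget _ h1, hget _ hr, h1, true_and]
    · rw [List.getElem?_eq_none (by omega)]
      simp [h1]
  constructor
  · rw [← Bool.not_eq_true, ← Bool.not_eq_true, hL, hR,
      ← card_better_lt_iff f hk hr hinj hl hr']
    have hmr : t[r] ∈ v.filter fun c => c ∈ t.toFinset := by
      simp [hmem _ (List.getElem_mem hr)]
    rw [List.mem_take_iff_idxOf_lt hmr, idxOf_filter _ _ (by simp)]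
    have hcard : ((v.take (v.idxOf t[r])).filter fun c => decide (c ∈ t.toFinset)).length =
        ((Finset.range t.length).filter fun i => f i < f r).card := by
      rw [← List.toFinset_card_of_nodup ((hvn.sublist (List.take_sublist _ _)).filter _)]
      symm
      refine Finset.card_bij (fun i _ => t.getD i 0) ?_ ?_ ?_
      · intro i hi
        rw [Finset.mem_filter, Finset.mem_range] at hi
        have h1 := List.getElem_mem hi.1
        have h2 := hi.2
        simp only [hf, hget _ hi.1, hget _ hr] at h2
        rw [hget _ hi.1, List.mem_toFinset, List.mem_filter, mem_take_idxOf]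
        exact ⟨⟨hmem _ h1, h2⟩, by simp⟩
      · intro i hi j hj h
        rw [Finset.mem_filter, Finset.mem_range] at hi hj
        exact hinj i hi.1 j hj.1 (by simp only [hf, h])
      · intro d hd
        rw [List.mem_toFinset, List.mem_filter, mem_take_idxOf] at hd
        obtain ⟨⟨hd1, hd2⟩, hd3⟩ := hd
        have hd3 : d ∈ t := by simpa using hd3
        obtain ⟨i, hi, rfl⟩ := List.getElem_of_mem hd3
        refine ⟨i, ?_, hget i hi⟩
        rw [Finset.mem_filter, Finset.mem_range]
        exact ⟨hi, by simpa only [hf, hget _ hi, hget _ hr] using hd2⟩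
    rw [hcard]
  -- With both neighbours better, ranks would worsen from the left neighbour to `r` and improve
  -- again to the right one.
  · rw [hL, hR]
    rintro ⟨⟨h1, h2⟩, h3, h4⟩
    have := hl _ _ _ (show r - k < r by omega) (show r < r + k by omega) h3 h2
    omega

theorem length_beating (V : List (List ℕ)) (o : Option ℕ) (c : ℕ) :
    (beating V o c).length = V.countP fun v => o.toList.any fun a => prefers v a c := by
  cases o <;> simp [beating, List.countP_eq_length_filter]

/-- The voters are those who approve of a candidate, and those counted by `losing`. -/
theorem score_add_losing {k : ℕ} (hk : 1 ≤ k) {axis t : List ℕ} {V : List (List ℕ)}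
    (haxis : axis.Nodup) (hV : ∀ v ∈ V, v.Perm axis) (hsp : ∀ v ∈ V, SinglePeaked axis v)
    (ht : t.Sublist axis) {r : ℕ} (hr : r < t.length) :
    kApprovalScore k (restrictVotes t.toFinset V) t[r] +
      (losing V (leftNbr k t r) (rightNbr k t r) t[r]).length = V.length := by
  rw [losing, List.length_append, length_beating, length_beating, kApprovalScore, restrictVotes,
    List.countP_map]
  induction V with
  | nil => simp
  | cons v V ih =>
    have h := ih (fun v hv => hV v (by simp [hv])) (fun v hv => hsp v (by simp [hv]))
    obtain ⟨h1, h2⟩ := vote_approves_iff hk haxis (hV v (by simp)) (hsp v (by simp)) ht hr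
    simp only [List.countP_cons, List.length_cons, Function.comp_apply, decide_eq_true_eq] at h ⊢
    simp only [h1]
    generalize List.countP ((fun v => decide (t[r] ∈ List.take k v)) ∘
      fun v => List.filter (fun c => decide (c ∈ t.toFinset)) v) V = x at h ⊢
    cases hL : (leftNbr k t r).toList.any (fun a => prefers v a t[r]) <;>
      cases hR : (rightNbr k t r).toList.any (fun a => prefers v a t[r]) <;>
      simp only [hL, hR] at h2 ⊢ <;> simp at h2 ⊢ <;> omega

theorem isUniqueWinner_kApproval_iff {α : Type} [DecidableEq α] {k : ℕ} {S : Finset α}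
    {V : List (List α)} {p : α} (hp : p ∈ S) :
    IsUniqueWinner (kApproval k) S V p ↔ ∀ c ∈ S, c ≠ p →
      kApprovalScore k (restrictVotes S V) c < kApprovalScore k (restrictVotes S V) p := by
  rw [IsUniqueWinner, kApproval, Finset.ext_iff]
  simp only [Finset.mem_filter, Finset.mem_singleton]
  constructor
  · intro h c hc hcp
    have h1 := ((h p).2 rfl).2
    by_contra h2
    exact hcp ((h c).1 ⟨hc, fun d hd => (h1 d hd).trans (not_lt.1 h2)⟩)
  · intro h c
    constructor
    · rintro ⟨hc, h1⟩
      by_contra h2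
      exact absurd (h1 p hp) (not_le.2 (h c hc h2))
    · rintro rfl
      refine ⟨hp, fun d hd => ?_⟩
      rcases eq_or_ne d c with rfl | hd'
      · exact le_rfl
      · exact (h d hd hd').le

/-- The unique winner in terms of the numbers of voters that do not approve. -/
theorem isUniqueWinner_iff_losing {k : ℕ} (hk : 1 ≤ k) {axis t : List ℕ} {V : List (List ℕ)}
    (haxis : axis.Nodup) (hV : ∀ v ∈ V, v.Perm axis) (hsp : ∀ v ∈ V, SinglePeaked axis v)
    (ht : t.Sublist axis) {s : ℕ} (hs : s < t.length) :
    IsUniqueWinner (kApproval k) t.toFinset V t[s] ↔ ∀ r, (hr : r < t.length) → t[r] ≠ t[s] →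
      (losing V (leftNbr k t s) (rightNbr k t s) t[s]).length <
        (losing V (leftNbr k t r) (rightNbr k t r) t[r]).length := by
  rw [isUniqueWinner_kApproval_iff (by simp)]
  have key := fun r (hr : r < t.length) => score_add_losing hk haxis hV hsp ht hr
  constructor
  · intro h r hr hrs
    have := h t[r] (by simp) hrs
    have := key r hr
    have := key s hs
    omega
  · intro h c hc hcs
    obtain ⟨r, hr, rfl⟩ := List.getElem_of_mem (List.mem_toFinset.1 hc)
    have := h r hr hcs
    have := key r hr
    have := key s hs
    omega

end SinglePeakedScores

/-! ### Correctness of the algorithm -/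

section Correctness

theorem mem_listsOfLength {α : Type} {o : List α} {n : ℕ} {w : List α} :
    w ∈ listsOfLength o n ↔ w.length = n ∧ ∀ x ∈ w, x ∈ o := by
  induction n generalizing w with
  | zero => cases w <;> simp [listsOfLength]
  | succ n ih =>
    cases w with
    | nil => simp [listsOfLength]
    | cons x w =>
      simp only [listsOfLength, List.mem_flatMap, List.mem_map, List.cons.injEq, List.length_cons,
        List.mem_cons, forall_eq_or_imp, Nat.add_right_cancel_iff]
      constructor
      · rintro ⟨_, h, _, hx, rfl, rfl⟩
        exact ⟨(ih.1 h).1, hx, (ih.1 h).2⟩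
      · rintro ⟨h1, h2, h3⟩
        exact ⟨w, ih.2 ⟨h1, h3⟩, x, h2, rfl, rfl⟩

theorem mem_scanStates {k : ℕ} {o : List (Option ℕ)} {J : List ℕ} {q : ScanState} :
    q ∈ scanStates k o J ↔ (q.1.length = 2 * k ∧ ∀ x ∈ q.1, x ∈ o) ∧ q.2.1 ∈ J := by
  obtain ⟨W, j, a, b⟩ := q
  simp only [scanStates, List.mem_flatMap, List.mem_map, mem_listsOfLength, Prod.mk.injEq]
  constructor
  · rintro ⟨_, h, _, hj, _, _, _, _, rfl, rfl, rfl, rfl⟩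
    exact ⟨h, hj⟩
  · rintro ⟨h, hj⟩
    exact ⟨W, h, j, hj, a, by cases a <;> simp, b, by cases b <;> simp, rfl, rfl, rfl, rfl⟩

theorem mem_budgets {bound j : ℕ} {l : List ℕ} :
    j ∈ budgets bound l ↔ j ≤ min bound l.length := by
  have := budgets_fold bound l 0 (Nat.zero_le _)
  simp only [zero_add, List.range_one, List.reverse_singleton] at this
  rw [budgets, this]
  simp only [List.mem_reverse, List.mem_range]
  omega

/-- The number of accepting runs from a state. -/
def scanCount (k : ℕ) (V : List (List ℕ)) (p : ℕ) (l₀ r₀ : Option ℕ) (want : Bool)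
    (Q : List ScanState) : List ScanItem → ScanState → ℕ
  | [], q => if q ∈ Q then bif q.2.2.1 && q.2.2.2 == want then 1 else 0 else 0
  | x :: l, q => if q ∈ Q then
      ((scanMoves k V p l₀ r₀ x q).map fun q' => scanCount k V p l₀ r₀ want Q l q').sum else 0

/-- The table memoises the recursion of `scanCount`: the first item is the last one folded in. -/
theorem lookupOr_scanTable (k : ℕ) (V : List (List ℕ)) (p : ℕ) (l₀ r₀ : Option ℕ) (want : Bool)
    (Q : List ScanState) (l : List ScanItem) (q : ScanState) :
    lookupOr (scanTable k V p l₀ r₀ want Q l) q = scanCount k V p l₀ r₀ want Q l q := by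
  induction l generalizing q with
  | nil =>
    rw [scanTable, List.reverse_nil, List.foldl_nil, lookupOr_map, scanCount]
    congr
  | cons x l ih =>
    have h : scanTable k V p l₀ r₀ want Q (x :: l) = Q.map fun q =>
        (q, ((scanMoves k V p l₀ r₀ x q).map fun q' =>
          lookupOr (scanTable k V p l₀ r₀ want Q l) q').sum) := by
      simp only [scanTable, List.reverse_cons, List.foldl_append, List.foldl_cons, List.foldl_nil]
    rw [h, lookupOr_map]
    simp only [ih, scanCount]

/-- The sequences of participants, with their costs. -/
def scanChoices : List ScanItem → List (List (Option ℕ) × ℕ)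
  | [] => [([], 0)]
  | x :: l => (scanChoices l).map (fun c => (x.1 :: c.1, x.2.1 + c.2)) ++
      x.2.2.toList.flatMap fun s => (scanChoices l).map fun c => (c.1, s + c.2)

/-- The final flags of the automaton that reads a given sequence of participants. -/
def scanFlags (k : ℕ) (V : List (List ℕ)) (p : ℕ) (l₀ r₀ : Option ℕ) :
    List (Option ℕ) → Bool × Bool → List (Option ℕ) → Bool × Bool
  | _, f, [] => f
  | W, f, y :: ys => scanFlags k V p l₀ r₀ ((y :: W).take (2 * k))
      (f.1 && guessOk p l₀ r₀ (nthOr (y :: W) (2 * k)) (nthOr (y :: W) k) y,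
        f.2 || beats V p l₀ r₀ (nthOr (y :: W) (2 * k)) (nthOr (y :: W) k) y) ys

def scanAccepts (k : ℕ) (V : List (List ℕ)) (p : ℕ) (l₀ r₀ : Option ℕ) (want : Bool)
    (W : List (Option ℕ)) (f : Bool × Bool) (ys : List (Option ℕ)) : Bool :=
  (scanFlags k V p l₀ r₀ W f ys).1 && (scanFlags k V p l₀ r₀ W f ys).2 == want

/-- Windows keep length `2 * k` and entries in `o`, so a run leaves the state set only by exceeding
the budget. As costs never decrease, cutting such runs off early agrees with checking the total cost
at the end. -/
theorem scanCount_eq_countP (k : ℕ) (V : List (List ℕ)) (p : ℕ) (l₀ r₀ : Option ℕ) (want : Bool)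
    (o : List (Option ℕ)) (bound : ℕ) (axis : List ℕ) (l : List ScanItem)
    (hl : ∀ x ∈ l, x.1 ∈ o) : ∀ (W : List (Option ℕ)) (j : ℕ) (f : Bool × Bool),
    W.length = 2 * k → (∀ x ∈ W, x ∈ o) →
    scanCount k V p l₀ r₀ want (scanStates k o (budgets bound axis)) l (W, j, f) =
      (scanChoices l).countP fun c => decide (j + c.2 ≤ min bound axis.length) &&
        scanAccepts k V p l₀ r₀ want W f c.1 := by
  induction l with
  | nil =>
    intro W j f hW hWo
    have hq : (W, j, f) ∈ scanStates k o (budgets bound axis) ↔ j ≤ min bound axis.length := by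
      rw [mem_scanStates, mem_budgets]
      exact and_iff_right ⟨hW, hWo⟩
    simp only [scanCount, hq, scanChoices, List.countP_singleton, scanAccepts, scanFlags, add_zero]
    by_cases hj : j ≤ min bound axis.length
    · simp only [hj, if_true, decide_true, Bool.true_and]
      cases f.1 && f.2 == want <;> rfl
    · simp [hj]
  | cons x l ih =>
    intro W j f hW hWo
    have hq : (W, j, f) ∈ scanStates k o (budgets bound axis) ↔ j ≤ min bound axis.length := by
      rw [mem_scanStates, mem_budgets]
      exact and_iff_right ⟨hW, hWo⟩
    have ih := ih fun y hy => hl y (by simp [hy])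
    have hW' : ((x.1 :: W).take (2 * k)).length = 2 * k := by simp [hW]
    have hWo' : ∀ y ∈ (x.1 :: W).take (2 * k), y ∈ o := by
      intro y hy
      rcases List.mem_cons.1 (List.mem_of_mem_take hy) with rfl | hy
      · exact hl x (by simp)
      · exact hWo y hy
    obtain ⟨y, t, s⟩ := x
    simp only [scanCount, hq, scanChoices, List.countP_append, List.countP_map, scanMoves]
    by_cases hj : j ≤ min bound axis.length
    · rw [if_pos hj, List.map_cons, List.sum_cons]
      congr 1
      · rw [scanTake, ih _ _ _ hW' hWo']
        refine List.countP_congr fun c _ => ?_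
        simp only [Function.comp_apply, add_assoc, scanAccepts, scanFlags]
      · cases s with
        | none => simp
        | some s =>
          simp only [Option.toList_some, List.map_cons, List.map_nil, List.sum_cons, List.sum_nil,
            List.flatMap_cons, List.flatMap_nil, List.append_nil, List.countP_map, add_zero]
          rw [ih _ _ _ hW hWo]
          refine List.countP_congr fun c _ => ?_
          simp only [Function.comp_apply, add_assoc]
    -- The budget is already exceeded, and further costs are nonnegative.
    · rw [if_neg hj]
      symm
      rw [Nat.add_eq_zero_iff]
      refine ⟨List.countP_eq_zero.2 fun c _ => ?_, List.countP_eq_zero.2 fun c hc => ?_⟩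
      · simp only [Function.comp_apply, Bool.and_eq_true, decide_eq_true_eq]
        omega
      · simp only [Bool.and_eq_true, decide_eq_true_eq]
        omega

theorem scanChoices_append_dummies (l : List ScanItem) (n : ℕ) :
    scanChoices (l ++ List.replicate n (none, 0, none)) =
      (scanChoices l).map fun c => (c.1 ++ List.replicate n none, c.2) := by
  induction l with
  | nil =>
    induction n with
    | zero => rfl
    | succ n ih =>
      rw [List.nil_append] at ih
      simp [List.replicate_succ, scanChoices, ih]
  | cons x l ih => simp [scanChoices, ih, Function.comp_def, List.map_flatMap]

/-- The participants, when the candidates in `X` are added (`mode = true`) or deleted. -/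
def participants (mode : Bool) (O axis : List ℕ) (X : Finset ℕ) : List ℕ :=
  axis.filter fun x => decide (x ∉ O) || mode == decide (x ∈ X)

/-- Choices correspond to subsets `X`, with cost `X.card`: at each optional candidate the two moves
match the splitting of the powerset by membership. The test `H` is general so that the induction can
absorb the head of the sequence and its cost. -/
theorem countP_scanChoices (mode : Bool) (O axis : List ℕ) (h : axis.Nodup)
    (H : List (Option ℕ) → ℕ → Bool) :
    (scanChoices (axis.map fun x => bif O.any (fun y => y == x) then
        bif mode then (some x, 1, some 0) else (some x, 0, some 1)
      else (some x, 0, none))).countP (fun c => H c.1 c.2) =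
    ((axis.filter fun x => decide (x ∈ O)).toFinset.powerset.filter fun X =>
      H ((participants mode O axis X).map some) X.card = true).card := by
  induction axis generalizing H with
  | nil => cases h : H [] 0 <;> simp [scanChoices, participants, h, Finset.filter_singleton]
  | cons x l ih =>
    obtain ⟨hx, hl⟩ := List.nodup_cons.1 h
    have hp : ∀ X : Finset ℕ, participants mode O l (insert x X) = participants mode O l X := by
      intro X
      refine List.filter_congr fun y hy => ?_
      have : y ≠ x := fun h => hx (h ▸ hy)
      simp [this]
    by_cases hO : x ∈ O
    · have h1 : (O.any fun y => y == x) = true := by simpa using hO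
      have hx' : x ∉ (l.filter fun x => decide (x ∈ O)).toFinset := by simp [hx]
      have hsub : ∀ X ∈ (l.filter fun x => decide (x ∈ O)).toFinset.powerset, x ∉ X :=
        fun X hX hxX => hx' (Finset.mem_powerset.1 hX hxX)
      have e1 : ((x :: l).filter fun x => decide (x ∈ O)).toFinset =
          insert x (l.filter fun x => decide (x ∈ O)).toFinset := by simp [hO]
      rw [e1, Finset.card_filter, Finset.sum_powerset_insert hx', List.map_cons, scanChoices,
        List.countP_append, List.countP_map]
      cases mode with
      | true =>
        have e2 : ∀ X ∈ (l.filter fun x => decide (x ∈ O)).toFinset.powerset,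
            participants true O (x :: l) X = participants true O l X := by
          intro X hX
          simp [participants, hO, hsub X hX]
        have e3 : ∀ X, participants true O (x :: l) (insert x X) =
            x :: participants true O l X := by
          intro X
          rw [← hp X]
          simp [participants]
        -- When candidates are added, the first move (participation) matches `x ∈ X`, which is the
        -- second summand of the powerset sum. When they are deleted, the orders agree.
        rw [add_comm]
        congr 1
        · have := ih hl H
          simp only [h1, cond_true, Option.toList_some, List.flatMap_cons, List.flatMap_nil,
            List.append_nil, List.countP_map, Function.comp_def, zero_add] at this ⊢
          rw [this, Finset.card_filter]
          exact Finset.sum_congr rfl fun X hX => by rw [e2 X hX]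
        · have := ih hl fun t c => H (some x :: t) (1 + c)
          simp only [h1, cond_true, Function.comp_def] at this ⊢
          rw [this, Finset.card_filter]
          refine Finset.sum_congr rfl fun X hX => ?_
          rw [e3, Finset.card_insert_of_notMem (hsub X hX), List.map_cons, add_comm 1]
      | false =>
        have e2 : ∀ X ∈ (l.filter fun x => decide (x ∈ O)).toFinset.powerset,
            participants false O (x :: l) X = x :: participants false O l X := by
          intro X hX
          simp [participants, hsub X hX]
        have e3 : ∀ X, participants false O (x :: l) (insert x X) =
            participants false O l X := by
          intro X
          rw [← hp X]
          simp [participants, hO]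
        congr 1
        · have := ih hl fun t c => H (some x :: t) c
          simp only [h1, cond_true, cond_false, Function.comp_def, zero_add] at this ⊢
          rw [this, Finset.card_filter]
          exact Finset.sum_congr rfl fun X hX => by rw [e2 X hX, List.map_cons]
        · have := ih hl fun t c => H t (1 + c)
          simp only [h1, cond_true, cond_false, Option.toList_some, List.flatMap_cons,
            List.flatMap_nil, List.append_nil, List.countP_map, Function.comp_def] at this ⊢
          rw [this, Finset.card_filter]
          refine Finset.sum_congr rfl fun X hX => ?_
          rw [e3, Finset.card_insert_of_notMem (hsub X hX), add_comm 1]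
    · have h1 : (O.any fun y => y == x) = false := by
        rw [Bool.eq_false_iff]; simpa using hO
      have e1 : ((x :: l).filter fun x => decide (x ∈ O)).toFinset =
          (l.filter fun x => decide (x ∈ O)).toFinset := by simp [hO]
      have e2 : ∀ X, participants mode O (x :: l) X = x :: participants mode O l X := by
        intro X
        simp [participants, hO]
      have := ih hl fun t c => H (some x :: t) c
      rw [e1, List.map_cons, scanChoices, List.countP_append, List.countP_map]
      simp only [h1, cond_false, Function.comp_def, zero_add, Option.toList_none,
        List.flatMap_nil, List.countP_nil, add_zero] at this ⊢
      rw [this]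
      simp only [e2, List.map_cons]

theorem nthOr_eq (l : List (Option ℕ)) (n : ℕ) : nthOr l n = l.getD n none := by
  rw [nthOr, List.headD_eq_head?_getD, List.head?_drop, List.getD_eq_getElem?_getD]

/-- The reversed window followed by the unread entries is a section of the padded sequence of
participants. The candidate being judged and its neighbours are at offsets `k`, `0` and `2 * k` in
it, and reading an entry shifts the section by one. -/
theorem window_facts {k : ℕ} {W : List (Option ℕ)} (hW : W.length = 2 * k) (y : Option ℕ)
    (ys : List (Option ℕ)) :
    nthOr (y :: W) (2 * k) = (W.reverse ++ y :: ys).getD 0 none ∧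
    nthOr (y :: W) k = (W.reverse ++ y :: ys).getD k none ∧
    y = (W.reverse ++ y :: ys).getD (2 * k) none ∧
    ∀ i, (((y :: W).take (2 * k)).reverse ++ ys).getD i none =
      (W.reverse ++ y :: ys).getD (i + 1) none := by
  have h : W.reverse ++ y :: ys = (y :: W).reverse ++ ys := by simp
  have h2 : ∀ j, j ≤ 2 * k →
      (W.reverse ++ y :: ys).getD j none = (y :: W).getD (2 * k - j) none := by
    intro j hj
    rw [h, List.getD_eq_getElem?_getD, List.getElem?_append_left (by simp [hW]; omega),
      List.getElem?_reverse (by simp [hW]; omega), List.getD_eq_getElem?_getD]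
    congr 2
    simp [hW]
  refine ⟨?_, ?_, ?_, ?_⟩
  · rw [nthOr_eq, h2 0 (by omega), Nat.sub_zero]
  · rw [nthOr_eq, h2 k (by omega)]
    congr 1
    omega
  · rw [h2 (2 * k) le_rfl]
    simp
  · intro i
    have h3 : ((y :: W).take (2 * k)).reverse = (y :: W).reverse.tail := by
      rw [List.tail_reverse, List.dropLast_eq_take, List.length_cons, hW, Nat.add_sub_cancel]
    have h4 : (y :: W).reverse.tail ++ ys = ((y :: W).reverse ++ ys).tail := by
      rw [List.tail_append_of_ne_nil (by simp)]
    rw [h3, h4, h, List.getD_eq_getElem?_getD, List.getElem?_tail, ← List.getD_eq_getElem?_getD]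

/-- By `window_facts`, the flags accumulate a local condition over all sections of length `2 * k +
1` of the padded sequence: here a conjunction, in `scanFlags_snd` a disjunction. -/
theorem scanFlags_fst (k : ℕ) (V : List (List ℕ)) (p : ℕ) (l₀ r₀ : Option ℕ)
    (ys : List (Option ℕ)) : ∀ (W : List (Option ℕ)) (f : Bool × Bool), W.length = 2 * k →
    ((scanFlags k V p l₀ r₀ W f ys).1 = true ↔ f.1 = true ∧ ∀ i < ys.length,
      guessOk p l₀ r₀ ((W.reverse ++ ys).getD i none) ((W.reverse ++ ys).getD (i + k) none)
        ((W.reverse ++ ys).getD (i + 2 * k) none) = true) := by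
  induction ys with
  | nil => intro W f _; simp [scanFlags]
  | cons y ys ih =>
    intro W f hW
    obtain ⟨h1, h2, h3, h4⟩ := window_facts hW y ys
    rw [scanFlags, ih _ _ (by simp [hW]), List.length_cons, Nat.forall_lt_succ_left]
    simp only [h4, h1, h2, Bool.and_eq_true, zero_add, ← h3, add_right_comm _ 1, and_assoc]

theorem scanFlags_snd (k : ℕ) (V : List (List ℕ)) (p : ℕ) (l₀ r₀ : Option ℕ)
    (ys : List (Option ℕ)) : ∀ (W : List (Option ℕ)) (f : Bool × Bool), W.length = 2 * k →
    ((scanFlags k V p l₀ r₀ W f ys).2 = true ↔ f.2 = true ∨ ∃ i < ys.length,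
      beats V p l₀ r₀ ((W.reverse ++ ys).getD i none) ((W.reverse ++ ys).getD (i + k) none)
        ((W.reverse ++ ys).getD (i + 2 * k) none) = true) := by
  induction ys with
  | nil => intro W f _; simp [scanFlags]
  | cons y ys ih =>
    intro W f hW
    obtain ⟨h1, h2, h3, h4⟩ := window_facts hW y ys
    rw [scanFlags, ih _ _ (by simp [hW]), List.length_cons, Nat.exists_lt_succ_left]
    simp only [h4, h1, h2, Bool.or_eq_true, zero_add, ← h3, add_right_comm _ 1, or_assoc]

theorem padded_getD (k : ℕ) (t : List ℕ) (n : ℕ) :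
    ((List.replicate (2 * k) none).reverse ++
      (t.map some ++ List.replicate k none)).getD n none =
      if 2 * k ≤ n then t[n - 2 * k]? else none := by
  rw [List.getD_eq_getElem?_getD, List.reverse_replicate]
  split_ifs with h
  · rw [List.getElem?_append_right (by simpa using h), List.length_replicate]
    by_cases h2 : n - 2 * k < t.length
    · rw [List.getElem?_append_left (by simpa using h2)]
      simp [h2]
    · rw [List.getElem?_append_right (by simpa using h2), List.getElem?_eq_none (l := t) (by omega),
        List.getElem?_replicate]
      split_ifs <;> rfl
  · rw [List.getElem?_append_left (by simpa using h), List.getElem?_replicate]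
    split_ifs <;> rfl

/-- The padding, `2 * k` dummies in front and `k` behind, makes every participant the centre of
exactly one section, with missing neighbours read as `none`. The first `k` sections have a dummy as
centre and impose no condition. -/
theorem scanAccepts_iff {k : ℕ} (V : List (List ℕ)) {p : ℕ} (l₀ r₀ : Option ℕ) (want : Bool)
    {t : List ℕ} (ht : t.Nodup) {s : ℕ} (hs : s < t.length) (hp : t[s] = p) :
    scanAccepts k V p l₀ r₀ want (List.replicate (2 * k) none) (true, false)
      (t.map some ++ List.replicate k none) = true ↔
    leftNbr k t s = l₀ ∧ rightNbr k t s = r₀ ∧ ((∃ r, ∃ hr : r < t.length, t[r] ≠ p ∧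
      (losing V (leftNbr k t r) (rightNbr k t r) t[r]).length ≤ (losing V l₀ r₀ p).length) ↔
        want = true) := by
  -- The section with index `i ≥ k` is centred at the participant with index `i - k`; the `k`
  -- dummies at the end make these reach the last participant.
  have hcase : ∀ i, i < (t.map some ++ List.replicate k (none : Option ℕ)).length → k ≤ i →
      ∃ r, ∃ hr : r < t.length, i = r + k ∧
      (if 2 * k ≤ i then t[i - 2 * k]? else none) = leftNbr k t r ∧
      (if 2 * k ≤ i + k then t[i + k - 2 * k]? else none) = some t[r] ∧
      (if 2 * k ≤ i + 2 * k then t[i + 2 * k - 2 * k]? else none) = rightNbr k t r := by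
    intro i hi hik
    simp only [List.length_append, List.length_map, List.length_replicate] at hi
    have hr : i - k < t.length := by omega
    refine ⟨i - k, hr, by omega, ?_, ?_, ?_⟩
    · unfold leftNbr
      by_cases h : 2 * k ≤ i
      · rw [if_pos h, if_pos (by omega)]; congr 1; omega
      · rw [if_neg h, if_neg (by omega)]
    · rw [if_pos (by omega), show i + k - 2 * k = i - k by omega, List.getElem?_eq_getElem hr]
    · unfold rightNbr
      rw [if_pos (by omega)]; congr 1; omega
  rw [scanAccepts, Bool.and_eq_true, ← and_assoc]
  refine and_congr ?_ ?_
  · rw [scanFlags_fst k V p l₀ r₀ _ _ _ (by simp)]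
    simp only [true_and, padded_getD]
    constructor
    · intro h
      have h1 : s + k < (t.map some ++ List.replicate k (none : Option ℕ)).length := by
        simpa using hs
      have h2 := h (s + k) h1
      obtain ⟨r, hr, e0, e1, e2, e3⟩ := hcase _ h1 (by omega)
      obtain rfl : s = r := by omega
      rw [e1, e2, e3, guessOk, hp] at h2
      simpa using h2
    · rintro ⟨h1, h2⟩ i hi
      by_cases hik : k ≤ i
      · obtain ⟨r, hr, e0, e1, e2, e3⟩ := hcase i hi hik
        rw [e1, e2, e3, guessOk]
        by_cases hrs : t[r] = p
        · have : r = s := (ht.getElem_inj_iff).1 (hrs.trans hp.symm)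
          subst this
          simp [h1, h2]
        · simp [hrs]
      · rw [if_neg (show ¬ 2 * k ≤ i + k by omega)]
        simp [guessOk]
  · have key : (scanFlags k V p l₀ r₀ (List.replicate (2 * k) none) (true, false)
        (t.map some ++ List.replicate k none)).2 = true ↔
        ∃ r, ∃ hr : r < t.length, t[r] ≠ p ∧
          (losing V (leftNbr k t r) (rightNbr k t r) t[r]).length ≤
            (losing V l₀ r₀ p).length := by
      rw [scanFlags_snd k V p l₀ r₀ _ _ _ (by simp)]
      simp only [Bool.false_eq_true, false_or, padded_getD]
      constructor
      · rintro ⟨i, hi, h⟩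
        by_cases hik : k ≤ i
        · obtain ⟨r, hr, e0, e1, e2, e3⟩ := hcase i hi hik
          rw [e1, e2, e3, beats] at h
          refine ⟨r, hr, ?_⟩
          simpa [List.drop_eq_nil_iff] using h
        · rw [if_neg (show ¬ 2 * k ≤ i + k by omega)] at h
          simp [beats] at h
      · rintro ⟨r, hr, h⟩
        have h1 : r + k < (t.map some ++ List.replicate k (none : Option ℕ)).length := by
          simpa using hr
        refine ⟨r + k, h1, ?_⟩
        obtain ⟨r', hr', e0, e1, e2, e3⟩ := hcase _ h1 (by omega)
        obtain rfl : r = r' := by omega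
        rw [e1, e2, e3, beats]
        simpa [List.drop_eq_nil_iff] using h
    rw [← key, beq_iff_eq, Bool.eq_iff_iff]

/-- Each `X` contributes to the sum only for the single guess `(g X, g' X)`, so nothing is counted
twice. -/
theorem sum_card_guess {ι κ : Type} [DecidableEq κ] (P : Finset ι) (O : Finset κ) (g g' : ι → κ)
    (hg : ∀ X ∈ P, g X ∈ O) (hg' : ∀ X ∈ P, g' X ∈ O) (R : ι → κ → κ → Prop)
    [∀ X l r, Decidable (R X l r)] :
    ∑ l ∈ O, ∑ r ∈ O, (P.filter fun X => g X = l ∧ g' X = r ∧ R X l r).card =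
      (P.filter fun X => R X (g X) (g' X)).card := by
  simp only [Finset.card_filter]
  rw [Finset.sum_congr rfl fun l _ => Finset.sum_comm, Finset.sum_comm]
  refine Finset.sum_congr rfl fun X hX => ?_
  rw [Finset.sum_eq_single (g X), Finset.sum_eq_single (g' X)]
  · simp
  · intro r _ hr
    rw [if_neg fun h => hr h.2.1.symm]
  · exact fun h => absurd (hg' X hX) h
  · intro l _ hl
    exact Finset.sum_eq_zero fun r _ => if_neg fun h => hl h.1.symm
  · exact fun h => absurd (hg X hX) h

-- The beaten flag is the negation of the criterion `isUniqueWinner_iff_losing`; thus `want = true`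
-- counts the sets for which `p` is not the unique winner, `want = false` those for which it is.
open Classical in
theorem solve_eq {k : ℕ} (hk : 1 ≤ k) (mode want : Bool) {axis O : List ℕ} {V : List (List ℕ)}
    {p : ℕ} (bound : ℕ) (haxis : axis.Nodup) (hV : ∀ v ∈ V, v.Perm axis)
    (hsp : ∀ v ∈ V, SinglePeaked axis v) (hp : p ∈ axis) (hpO : p ∉ O) :
    solve k mode want axis O V p bound =
      ((axis.filter fun x => decide (x ∈ O)).toFinset.powerset.filter fun X =>
        X.card ≤ bound ∧ (IsUniqueWinner (kApproval k) (participants mode O axis X).toFinset V p ↔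
          want = false)).card := by
  set o : List (Option ℕ) := none :: axis.map some with ho
  have hon : o.Nodup := by
    rw [ho, List.nodup_cons]
    exact ⟨by simp, haxis.map (Option.some_injective _)⟩
  set P := (axis.filter fun x => decide (x ∈ O)).toFinset.powerset with hP
  have hsub : ∀ X, (participants mode O axis X).Sublist axis := fun X => List.filter_sublist
  have hpt : ∀ X, p ∈ participants mode O axis X := fun X => by simp [participants, hp, hpO]
  set pos : Finset ℕ → ℕ := fun X => (participants mode O axis X).idxOf p with hpos
  have hpos1 : ∀ X, pos X < (participants mode O axis X).length := fun X =>
    List.idxOf_lt_length_iff.2 (hpt X)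
  have hpos2 : ∀ X, (participants mode O axis X)[pos X]'(hpos1 X) = p := fun X =>
    List.getElem_idxOf (hpos1 X)
  have hopt : ∀ X (n : ℕ), (participants mode O axis X)[n]? ∈ o := by
    intro X n
    cases h : (participants mode O axis X)[n]? with
    | none => simp [ho]
    | some a => simpa [ho] using (hsub X).subset (List.mem_of_getElem? h)
  have hleft : ∀ X, leftNbr k (participants mode O axis X) (pos X) ∈ o := fun X => by
    unfold leftNbr
    split_ifs
    · exact hopt X _
    · simp [ho]
  have hcard : ∀ X ∈ P, X.card ≤ axis.length := fun X hX =>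
    (Finset.card_le_card (Finset.mem_powerset.1 hX)).trans
      ((List.toFinset_card_le _).trans (List.length_filter_le _ _))
  -- For a fixed guess, the initial state counts the sets within the bound for which the guess is
  -- right and the comparison with the guessed score of `p` has the wanted outcome.
  have hone : ∀ l₀ r₀ : Option ℕ, lookupOr (scanTable k V p l₀ r₀ want
      (scanStates k o (budgets bound axis)) (scanItems k mode O axis))
        (List.replicate (2 * k) none, 0, true, false) =
      (P.filter fun X => leftNbr k (participants mode O axis X) (pos X) = l₀ ∧
        rightNbr k (participants mode O axis X) (pos X) = r₀ ∧ (X.card ≤ bound ∧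
          ((∃ r, ∃ hr : r < (participants mode O axis X).length,
            (participants mode O axis X)[r] ≠ p ∧
            (losing V (leftNbr k (participants mode O axis X) r)
              (rightNbr k (participants mode O axis X) r)
              (participants mode O axis X)[r]).length ≤ (losing V l₀ r₀ p).length) ↔
            want = true))).card := by
    intro l₀ r₀
    rw [lookupOr_scanTable, scanCount_eq_countP, scanItems, scanChoices_append_dummies,
      List.countP_map]
    · refine (countP_scanChoices mode O axis haxis fun t c =>
        decide (0 + c ≤ min bound axis.length) && scanAccepts k V p l₀ r₀ want
          (List.replicate (2 * k) none) (true, false) (t ++ List.replicate k none)).trans ?_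
      congr 1
      refine Finset.filter_congr fun X hX => ?_
      rw [Bool.and_eq_true, scanAccepts_iff V l₀ r₀ want ((hsub X).nodup haxis) (hpos1 X)
        (hpos2 X), decide_eq_true_eq, zero_add]
      have := hcard X hX
      have hb : X.card ≤ min bound axis.length ↔ X.card ≤ bound := by omega
      rw [hb]
      exact ⟨fun ⟨a, b, c, d⟩ => ⟨b, c, a, d⟩, fun ⟨b, c, a, d⟩ => ⟨a, b, c, d⟩⟩
    · intro x hx
      rw [scanItems, List.mem_append] at hx
      rcases hx with hx | hx
      · obtain ⟨a, ha, rfl⟩ := List.mem_map.1 hx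
        have : some a ∈ o := by simpa [ho] using ha
        cases O.any fun y => y == a <;> cases mode <;> simpa using this
      · rw [List.eq_of_mem_replicate hx]
        simp [ho]
    · simp
    · intro x hx
      rw [List.eq_of_mem_replicate hx]
      simp [ho]
  have hsum : ∀ h : Option ℕ → Option ℕ → ℕ, (o.flatMap fun l₀ => o.map fun r₀ => h l₀ r₀).sum =
      ∑ l₀ ∈ o.toFinset, ∑ r₀ ∈ o.toFinset, h l₀ r₀ := by
    intro h
    simp only [List.sum_toFinset _ hon]
    rw [List.flatMap, List.sum_flatten, List.map_map]
    rfl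
  have hs : solve k mode want axis O V p bound = ∑ l₀ ∈ o.toFinset, ∑ r₀ ∈ o.toFinset,
      lookupOr (scanTable k V p l₀ r₀ want (scanStates k o (budgets bound axis))
        (scanItems k mode O axis)) (List.replicate (2 * k) none, 0, true, false) := hsum _
  rw [hs, Finset.sum_congr rfl fun l₀ _ => Finset.sum_congr rfl fun r₀ _ => hone l₀ r₀]
  rw [sum_card_guess P o.toFinset (fun X => leftNbr k (participants mode O axis X) (pos X))
    (fun X => rightNbr k (participants mode O axis X) (pos X))
    (fun X _ => List.mem_toFinset.2 (hleft X)) (fun X _ => List.mem_toFinset.2 (hopt X _))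
    (fun X l₀ r₀ => X.card ≤ bound ∧
          ((∃ r, ∃ hr : r < (participants mode O axis X).length,
            (participants mode O axis X)[r] ≠ p ∧
            (losing V (leftNbr k (participants mode O axis X) r)
              (rightNbr k (participants mode O axis X) r)
              (participants mode O axis X)[r]).length ≤ (losing V l₀ r₀ p).length) ↔
            want = true))]
  congr 1
  refine Finset.filter_congr fun X _ => and_congr_right fun _ => ?_
  have h1 := isUniqueWinner_iff_losing hk haxis hV hsp (hsub X) (hpos1 X)
  rw [hpos2] at h1
  rw [h1]
  have h2 : (∃ r, ∃ hr : r < (participants mode O axis X).length,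
      (participants mode O axis X)[r] ≠ p ∧
      (losing V (leftNbr k (participants mode O axis X) r)
        (rightNbr k (participants mode O axis X) r) (participants mode O axis X)[r]).length ≤
        (losing V (leftNbr k (participants mode O axis X) (pos X))
          (rightNbr k (participants mode O axis X) (pos X)) p).length) ↔
      ¬ ∀ r, (hr : r < (participants mode O axis X).length) →
      (participants mode O axis X)[r] ≠ p →
      (losing V (leftNbr k (participants mode O axis X) (pos X))
          (rightNbr k (participants mode O axis X) (pos X)) p).length <
      (losing V (leftNbr k (participants mode O axis X) r)
        (rightNbr k (participants mode O axis X) r) (participants mode O axis X)[r]).length := by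
    push Not
    rfl
  rw [h2]
  cases want <;> simp

end Correctness

/-! ### The four control problems as instances of the algorithm -/

section MainTheorem

open Classical in
theorem ACInstance.solve_eq {k : ℕ} (hk : 1 ≤ k) (want : Bool) (I : ACInstance ℕ) :
    solve k true want I.axis I.A I.V I.p I.bound =
      (I.A.toFinset.powerset.filter fun A' => A'.card ≤ I.bound ∧
        (IsUniqueWinner (kApproval k) (I.C.toFinset ∪ A') I.V I.p ↔ want = false)).card := by
  have hmem : ∀ x, x ∈ I.axis ↔ x ∈ I.C ∨ x ∈ I.A := fun x => by
    rw [I.axis_perm.mem_iff, List.mem_append]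
  have hdis : ∀ x ∈ I.C, x ∉ I.A := fun x hx hx' =>
    List.disjoint_of_nodup_append (I.axis_perm.nodup_iff.1 I.axis_nodup) hx hx'
  rw [_root_.solve_eq hk true want I.bound I.axis_nodup I.votes_perm I.votes_singlePeaked
    ((hmem _).2 (.inl I.p_mem)) (hdis _ I.p_mem)]
  have e1 : (I.axis.filter fun x => decide (x ∈ I.A)).toFinset = I.A.toFinset := by
    ext x
    simp only [List.mem_toFinset, List.mem_filter, decide_eq_true_eq, hmem]
    tauto
  rw [e1]
  congr 1
  refine Finset.filter_congr fun X hX => ?_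
  have e2 : (participants true I.A I.axis X).toFinset = I.C.toFinset ∪ X := by
    ext x
    have h1 : x ∈ X → x ∈ I.A := fun hx => List.mem_toFinset.1 (Finset.mem_powerset.1 hX hx)
    have h2 := hdis x
    simp only [participants, List.mem_toFinset, List.mem_filter, Bool.or_eq_true,
      decide_eq_true_eq, beq_iff_eq, hmem, Finset.mem_union, true_eq_decide_iff]
    tauto
  rw [e2]

-- The optional candidates are all those on the axis except `p`; this expresses the condition that
-- `p` is not deleted.
open Classical in
theorem DCInstance.solve_eq {k : ℕ} (hk : 1 ≤ k) (want : Bool) (I : DCInstance ℕ) :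
    solve k false want I.axis (I.axis.filter fun x => !(x == I.p)) I.V I.p I.bound =
      (I.C.toFinset.powerset.filter fun C' => C'.card ≤ I.bound ∧ I.p ∉ C' ∧
        (IsUniqueWinner (kApproval k) (I.C.toFinset \ C') I.V I.p ↔ want = false)).card := by
  have hmem : ∀ x, x ∈ I.axis ↔ x ∈ I.C := fun x => I.axis_perm.mem_iff
  rw [_root_.solve_eq hk false want I.bound I.axis_nodup I.votes_perm I.votes_singlePeaked
    ((hmem _).2 I.p_mem) (by simp)]
  congr 1
  ext X
  have e1 : X ⊆ (I.axis.filter fun x =>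
      decide (x ∈ I.axis.filter fun x => !(x == I.p))).toFinset ↔
      X ⊆ I.C.toFinset ∧ I.p ∉ X := by
    simp only [Finset.subset_iff, List.mem_toFinset, List.mem_filter, decide_eq_true_eq, hmem,
      Bool.not_eq_true', beq_eq_false_iff_ne]
    constructor
    · exact fun h => ⟨fun x hx => (h hx).1, fun hp => (h hp).2.2 rfl⟩
    · exact fun h x hx => ⟨h.1 hx, h.1 hx, fun e => h.2 (e ▸ hx)⟩
  simp only [Finset.mem_filter, Finset.mem_powerset, e1]
  have e2 : I.p ∉ X → (participants false (I.axis.filter fun x => !(x == I.p)) I.axis X).toFinset =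
      I.C.toFinset \ X := by
    intro hp
    ext x
    have h1 : x = I.p → x ∉ X := fun h => h ▸ hp
    simp only [participants, List.mem_toFinset, List.mem_filter, Bool.or_eq_true,
      decide_eq_true_eq, beq_iff_eq, hmem, Finset.mem_sdiff, false_eq_decide_iff,
      Bool.not_eq_true', beq_eq_false_iff_ne]
    tauto
  constructor
  · rintro ⟨⟨h1, h2⟩, h3, h4⟩
    exact ⟨h1, h3, h2, by rwa [← e2 h2]⟩
  · rintro ⟨h1, h3, h2, h4⟩
    exact ⟨⟨h1, h2⟩, h3, by rwa [e2 h2]⟩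

theorem AC_polyTime (k : ℕ) (want : Bool) :
    PolyTime fun I : ACInstance ℕ => solve k true want I.axis I.A I.V I.p I.bound :=
  PolyTime.solve k true want PolyTime.AC_axis PolyTime.AC_A PolyTime.AC_V PolyTime.AC_p
    PolyTime.AC_bound

theorem DC_polyTime (k : ℕ) (want : Bool) :
    PolyTime fun I : DCInstance ℕ =>
      solve k false want I.axis (I.axis.filter fun x => !(x == I.p)) I.V I.p I.bound := by
  have ha := PolyTime.DC_axis
  have hp := PolyTime.DC_p
  exact PolyTime.solve k false want ha (by fun_prop) PolyTime.DC_V hp PolyTime.DC_bound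

theorem mainTheorem3 (k : ℕ) (hk : 1 ≤ k) :
    InFP ACInstance.word (countCCAC (kApproval k)) ∧
    InFP DCInstance.word (countCCDC (kApproval k)) ∧
    InFP ACInstance.word (countDCAC (kApproval k)) ∧
    InFP DCInstance.word (countDCDC (kApproval k)) := by
  refine ⟨?_, ?_, ?_, ?_⟩
  · convert (AC_polyTime k false).inFP using 1
    funext I
    rw [I.solve_eq hk, countCCAC]
    congr 1
    ext X
    simp
  · convert (DC_polyTime k false).inFP using 1
    funext I
    rw [I.solve_eq hk, countCCDC]
    congr 1
    ext X
    simp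
  · convert (AC_polyTime k true).inFP using 1
    funext I
    rw [I.solve_eq hk, countDCAC]
    congr 1
    ext X
    simp
  · convert (DC_polyTime k true).inFP using 1
    funext I
    rw [I.solve_eq hk, countDCDC]
    congr 1
    ext X
    simp

end MainTheorem
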